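/- Let $K$ be a field, let $n\ge 2$ be an integer, and let $R_1=K[[x_1,\dots,x_n]]$ and $R=R_1[[y]]$ be the formal power series rings. Write $XR=(x_1,\dots,x_n)R$, let $U=R_1\setminus\{0\}$, and say that a prime ideal $Q$ of $R$ is maximal in the generic fiber if its extension $Q\,U^{-1}R$ is a maximal ideal of $U^{-1}R$ (equivalently, if $Q$ is maximal among the prime ideals of $R$ with $Q\cap R_1=(0)$). Let $\dim$ denote Krull dimension. Let $P$ be a prime ideal of $R$ with $P\cap R_1=(0)$. (1) If $P\not\subseteq XR$, then $P=gR$ for some Weierstrass polynomial $g\in R_1[y]$, that is, a monic polynomial in $y$ whose coefficients other than the leading one lie in $(x_1,\dots,x_n)R_1$; moreover, $\dim R/P=n$, and $P$ is maximal in the generic fiber. (2) If $P\subseteq XR$, then there is a prime ideal $Q$ of $R$ with $P\subseteq Q$ such that $\dim R/Q=2$ and $Q$ is maximal in the generic fiber. Consequently, for every prime ideal $Q$ of $R$ that is maximal in the generic fiber, either $\dim R/Q=n$ and the map $R_1\to R/Q$ is injective and finite, or $\dim R/Q=2$ and $Q\subsetneq XR$. -/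

import Mathlib

/-- The generic fiber ring `U⁻¹ B` of a ring extension `A → B`, where `U` is the image in `B` of
the set of non-zero-divisors of `A` (the nonzero elements of `A` when `A` is a domain). -/
abbrev GenericFiberRing (A B : Type*) [CommRing A] [CommRing B] [Algebra A B] : Type _ :=
  Localization (Algebra.algebraMapSubmonoid B (nonZeroDivisors A))

/-- A prime ideal `Q` of `B` is maximal in the generic fiber of `A → B` if its extension to the
generic fiber ring is a maximal ideal. (A prime that meets `U` extends to the unit ideal, so it
is not maximal in the generic fiber.) -/
def IsMaximalInGenericFiber (A : Type*) {B : Type*} [CommRing A] [CommRing B] [Algebra A B]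
    (Q : Ideal B) : Prop :=
  Q.IsPrime ∧ (Q.map (algebraMap B (GenericFiberRing A B))).IsMaximal

/-- The power series ring `K[[x₁, …, xₙ]]`. -/
abbrev BaseRing (K : Type*) [Field K] (n : ℕ) : Type _ := MvPowerSeries (Fin n) K

/-- The power series ring `K[[x₁, …, xₙ]][[y]]`, an algebra over `K[[x₁, …, xₙ]]` through the
inclusion of the constants. -/
abbrev ExtRing (K : Type*) [Field K] (n : ℕ) : Type _ := PowerSeries (BaseRing K n)

/-- The ideal `(x₁, …, xₙ)` of `K[[x₁, …, xₙ]]`. -/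
noncomputable def varIdeal (K : Type*) [Field K] (n : ℕ) : Ideal (BaseRing K n) :=
  Ideal.span (Set.range fun i : Fin n => MvPowerSeries.X i)

/-- The ideal `(x₁, …, xₙ)` of `K[[x₁, …, xₙ]][[y]]`. -/
noncomputable def extVarIdeal (K : Type*) [Field K] (n : ℕ) : Ideal (ExtRing K n) :=
  (varIdeal K n).map (algebraMap (BaseRing K n) (ExtRing K n))

/-- A Weierstrass polynomial `yˢ + aₛ₋₁ yˢ⁻¹ + ⋯ + a₀` in `y`, with all `aᵢ ∈ (x₁, …, xₙ)`. -/
def IsWeierstrassPolynomial {K : Type*} [Field K] {n : ℕ}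
    (g : Polynomial (BaseRing K n)) : Prop :=
  g.IsDistinguishedAt (varIdeal K n)

universe u

/-! Write A = K[[x]], R = A[[y]], and let m be the maximal ideal of R. A prime P of R outside XR
with P ∩ A = 0 contains, by Weierstrass preparation, a Weierstrass polynomial, so R/P is finite over
A. Since A is integrally closed, the minimal polynomial of y over A generates P
(`exists_isDistinguishedAt_span_eq`). Going down gives dim R/P = n, and incomparability gives
maximality in the generic fiber.

Inside XR, let Q be maximal among the primes contained in XR with Q ∩ A = 0. The chain Q < XR < m
gives dim R/Q ≥ 2. The opposite inequality comes from two bounds on the height of M = XR/Q. If dim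
R/Q ≥ 3, a Noether normalization K[[y, z₁, …, zᵣ]] ⊆ R/Q with all zᵢ in M and r ≥ 2 exists, and
going down yields ht M ≥ 2 (`two_le_height_map_extVarIdeal`). On the other hand ht M ≤ 1
(`height_map_extVarIdeal_le_one`). Otherwise take w = x₁ and, by prime avoidance, z in (x)A outside
every minimal prime of w in R/Q, and consider the pencil z - cⱼw with slopes cⱼ in K[[y]].
Maximality of Q puts some nonzero a ∈ A into (z - c₀w) + Q, up to a factor outside XR. If the slopes
are transcendental over a field containing the coefficients of generators of Q, the same a works for
every j (`exists_generic_slopes`). So every prime inside M that contains a member of the pencil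
contains a; but infinitely many distinct height-one primes arise this way, and only finitely many
contain a (`exists_isPrime_mem_and_notMem_of_pencil`).

Generic slopes exist because E = Frac K[[y]] has uncountable transcendence degree over K. The
specialization takes place in E[[x]], and `mem_of_toGenericCoeffs_mem_map` brings memberships back
to R.

Finally, Q is maximal in the whole generic fiber: a strictly larger prime over 0 would lie outside
XR and have coheight n ≥ 2, too much. -/

open MvPowerSeries in
instance MvPowerSeries.instIsDomainOfNoZeroDivisors {σ R : Type*} [CommRing R] [IsDomain R] :
    IsDomain (MvPowerSeries σ R) := NoZeroDivisors.to_isDomain _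

/-! ### Normality of power series rings over Noetherian normal domains -/

namespace PowerSeries

/-- Over a field divisibility is comparison of orders, and m·ord g ≤ ord d + m·ord f for all m
forces ord g ≤ ord f. -/
theorem dvd_of_forall_pow_dvd_mul_pow {k : Type*} [Field k] {d f g : k⟦X⟧} (hd : d ≠ 0)
    (h : ∀ m : ℕ, g ^ m ∣ d * f ^ m) : g ∣ f := by
  by_cases hf : f = 0
  · simp [hf]
  have hg : g ≠ 0 := by
    rintro rfl
    have := h 1
    simp [hd, hf] at this
  have key : g.order ≤ f.order := by
    by_contra! hlt
    have h1 : ∀ m : ℕ, (m : ℕ∞) * g.order ≤ d.order + m * f.order := by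
      intro m
      obtain ⟨c, hc⟩ := h m
      have := congrArg order hc
      simp only [order_mul, order_pow, nsmul_eq_mul] at this
      rw [this]
      exact le_self_add
    obtain ⟨a, ha⟩ := ENat.ne_top_iff_exists.mp (mt order_eq_top.mp hf)
    obtain ⟨b, hb⟩ := ENat.ne_top_iff_exists.mp (mt order_eq_top.mp hg)
    obtain ⟨c, hc⟩ := ENat.ne_top_iff_exists.mp (mt order_eq_top.mp hd)
    rw [← ha, ← hb] at hlt
    -- With c = ord d, the exponent c + 1 is already large enough to contradict ord f < ord g.
    have h2 := h1 (c + 1)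
    rw [← ha, ← hb, ← hc] at h2
    norm_cast at hlt h2
    nlinarith
  obtain ⟨a, ha⟩ := ENat.ne_top_iff_exists.mp (mt order_eq_top.mp hf)
  obtain ⟨b, hb⟩ := ENat.ne_top_iff_exists.mp (mt order_eq_top.mp hg)
  rw [← ha, ← hb] at key
  have hab : b ≤ a := by exact_mod_cast key
  have e1 := X_pow_order_mul_divXPowOrder (f := f)
  have e2 := X_pow_order_mul_divXPowOrder (f := g)
  rw [← ha] at e1
  rw [← hb] at e2
  have hu : IsUnit (divXPowOrder g) := by
    rw [isUnit_iff_constantCoeff, isUnit_iff_ne_zero, ne_eq, constantCoeff_divXPowOrder_eq_zero_iff]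
    exact hg
  rw [← e1, ← e2]
  refine (hu.mul_right_dvd).mpr ?_
  exact (pow_dvd_pow X hab).mul_right _

variable {R : Type*} [CommRing R] [IsDomain R] [IsIntegrallyClosed R] [IsNoetherianRing R]

/-- Coefficients are treated by strong induction: once the earlier ones lie in R, subtracting them
makes the n-th coefficient the leading one. It is then almost integral over R, hence integral
because R is Noetherian. -/
theorem mem_range_map_of_isAlmostIntegral {k : Type*} [Field k] [Algebra R k] [IsFractionRing R k]
    {h : k⟦X⟧} (H : IsAlmostIntegral R⟦X⟧ h) : h ∈ (algebraMap R⟦X⟧ k⟦X⟧).range := by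
  have hinj : Function.Injective (algebraMap R k) := IsFractionRing.injective R k
  have hc : ∀ n, coeff n h ∈ (algebraMap R k).range := by
    intro n
    induction n using Nat.strong_induction_on with
    | _ n ih =>
    choose! c hc using ih
    set t : R⟦X⟧ := mk fun i => if i < n then c i else 0 with ht
    have hh : IsAlmostIntegral R⟦X⟧ (h - algebraMap R⟦X⟧ k⟦X⟧ t) :=
      (completeIntegralClosure R⟦X⟧ k⟦X⟧).sub_mem H (Subalgebra.algebraMap_mem _ t)
    have hX : X ^ n ∣ h - algebraMap R⟦X⟧ k⟦X⟧ t := by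
      rw [X_pow_dvd_iff]
      intro m hm
      simp [algebraMap_apply'', ht, hm, hc m hm]
    obtain ⟨u, hu⟩ := hX
    have hun : coeff n h = constantCoeff u := by
      have := congrArg (coeff n) hu
      rw [coeff_X_pow_mul'] at this
      simpa [algebraMap_apply'', ht] using this
    obtain ⟨d, hd, hdm⟩ := hh
    have hd0 : d ≠ 0 := nonZeroDivisors.ne_zero hd
    -- The lowest coefficient of d serves as the common denominator for the powers of the n-th
    -- coefficient of h.
    obtain ⟨a, v, hdv, hv⟩ : ∃ (a : ℕ) (v : R⟦X⟧), d = X ^ a * v ∧ constantCoeff v ≠ 0 :=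
      ⟨_, _, X_pow_order_mul_divXPowOrder.symm, by
        rwa [ne_eq, constantCoeff_divXPowOrder_eq_zero_iff]⟩
    have : IsAlmostIntegral R (coeff n h) := by
      refine ⟨constantCoeff v, mem_nonZeroDivisors_of_ne_zero hv, fun m => ?_⟩
      obtain ⟨w, hw⟩ := hdm m
      refine ⟨coeff (a + n * m) w, ?_⟩
      have := congrArg (coeff (a + n * m)) hw
      rw [hu, Algebra.smul_def, algebraMap_apply'', algebraMap_apply'', coeff_map] at this
      rw [this, mul_pow, ← pow_mul, hdv, map_mul (map (algebraMap R k)), map_pow, map_X,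
        show X ^ a * map (algebraMap R k) v * (X ^ (n * m) * u ^ m) =
          X ^ (a + n * m) * (map (algebraMap R k) v * u ^ m) by ring,
        coeff_X_pow_mul', if_pos le_rfl, Nat.sub_self, coeff_zero_eq_constantCoeff_apply, map_mul,
        map_pow, ← hun, Algebra.smul_def]
      congr 1
    exact IsIntegrallyClosed.isIntegral_iff.mp this.isIntegral
  choose c hc using hc
  exact ⟨mk c, by ext n; simp [algebraMap_apply'', hc]⟩

instance : IsIntegrallyClosed R⟦X⟧ := by
  rw [isIntegrallyClosed_iff (FractionRing R⟦X⟧)]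
  intro x hx
  obtain ⟨f, g, hg, rfl⟩ := IsFractionRing.div_surjective (A := R⟦X⟧) x
  have hg0 : g ≠ 0 := nonZeroDivisors.ne_zero hg
  have hgF : algebraMap R⟦X⟧ (FractionRing R⟦X⟧) g ≠ 0 := by simpa using hg0
  obtain ⟨d, hd, hdm⟩ := hx.isAlmostIntegral
  have hd0 : d ≠ 0 := nonZeroDivisors.ne_zero hd
  choose c hc using hdm
  have hcd : ∀ m, d * f ^ m = g ^ m * c m := by
    intro m
    apply IsFractionRing.injective R⟦X⟧ (FractionRing R⟦X⟧)
    simp only [map_mul, map_pow, hc, Algebra.smul_def, div_pow]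
    field_simp
  let k := FractionRing R
  have hinj : Function.Injective (algebraMap R⟦X⟧ k⟦X⟧) :=
    map_injective _ (IsFractionRing.injective R k)
  have hd' : algebraMap R⟦X⟧ k⟦X⟧ d ≠ 0 := by
    rwa [ne_eq, map_eq_zero_iff _ hinj]
  have hg' : algebraMap R⟦X⟧ k⟦X⟧ g ≠ 0 := by
    rwa [ne_eq, map_eq_zero_iff _ hinj]
  obtain ⟨h, hh⟩ : algebraMap R⟦X⟧ k⟦X⟧ g ∣ algebraMap R⟦X⟧ k⟦X⟧ f :=
    dvd_of_forall_pow_dvd_mul_pow hd' fun m => ⟨algebraMap R⟦X⟧ k⟦X⟧ (c m), by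
      rw [← map_pow, ← map_pow, ← map_mul, ← map_mul, hcd]⟩
  have hal : IsAlmostIntegral R⟦X⟧ h := by
    refine ⟨d, hd, fun m => ⟨c m, ?_⟩⟩
    apply mul_left_cancel₀ (pow_ne_zero m hg')
    rw [← map_pow, ← map_mul, ← hcd, map_mul, map_pow, hh, Algebra.smul_def, map_pow]
    ring
  obtain ⟨y, hy⟩ := mem_range_map_of_isAlmostIntegral hal
  refine ⟨y, ?_⟩
  rw [eq_div_iff hgF, ← map_mul]
  congr 1
  apply hinj
  rw [map_mul, hy, hh, mul_comm]

end PowerSeries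

/-! ### Normality, the ideal of the variables and the dimension of K[[x]] -/

namespace MvPowerSeries

theorem isIntegrallyClosed_fin (K : Type*) [Field K] (n : ℕ) :
    IsIntegrallyClosed (MvPowerSeries (Fin n) K) := by
  induction n with
  | zero => exact IsIntegrallyClosed.of_equiv (isEmptyEquiv (Fin 0) K).toRingEquiv.symm
  | succ n ih => exact IsIntegrallyClosed.of_equiv (finSuccEquiv K n).toRingEquiv.symm

instance {σ K : Type*} [Finite σ] [Field K] : IsIntegrallyClosed (MvPowerSeries σ K) := by
  cases nonempty_fintype σ
  have := isIntegrallyClosed_fin K (Fintype.card σ)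
  exact IsIntegrallyClosed.of_equiv (renameEquiv K (Fintype.equivFin σ)).toRingEquiv.symm

/-- Each nonconstant monomial is assigned to one variable dividing it. The control on the
coefficients of the cofactors lets the decomposition be iterated. -/
theorem exists_eq_sum_X_mul {σ R : Type*} [Fintype σ] [CommRing R] (f : MvPowerSeries σ R)
    (hf : constantCoeff f = 0) : ∃ g : σ → MvPowerSeries σ R, f = ∑ i, X i * g i ∧
      ∀ i m, coeff m (g i) = 0 ∨ coeff m (g i) = coeff (m + Finsupp.single i 1) f := by
  classical
  have hex : ∀ m : σ →₀ ℕ, m ≠ 0 → ∃ i, m i ≠ 0 := fun m hm => by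
    by_contra! h
    exact hm (Finsupp.ext h)
  rcases isEmpty_or_nonempty σ with hσ | hσ
  · refine ⟨isEmptyElim, ?_, isEmptyElim⟩
    ext m
    rw [Subsingleton.elim m 0]
    simpa using hf
  choose! c hc using hex
  let g : σ → MvPowerSeries σ R := fun i m =>
    if c (m + Finsupp.single i 1) = i then coeff (m + Finsupp.single i 1) f else 0
  have hg : ∀ i m, coeff m (g i) = if c (m + Finsupp.single i 1) = i then
    coeff (m + Finsupp.single i 1) f else 0 := fun _ _ => rfl
  refine ⟨g, ?_, fun i m => ?_⟩
  · ext m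
    rw [map_sum]
    have hco : ∀ i, coeff m (X i * g i) = if m i ≠ 0 ∧ c m = i then coeff m f else 0 := by
      intro i
      rw [show (X i : MvPowerSeries σ R) = monomial (Finsupp.single i 1) 1 from rfl,
        coeff_monomial_mul]
      by_cases hmi : m i = 0
      · simp [hmi]
      · have hle : Finsupp.single i 1 ≤ m := by simpa using Nat.one_le_iff_ne_zero.mpr hmi
        rw [if_pos hle, one_mul, hg, tsub_add_cancel_of_le hle]
        simp [hmi]
    simp_rw [hco]
    by_cases hm : m = 0
    · subst hm
      simpa using hf
    · rw [Finset.sum_eq_single (c m)]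
      · simp [hc m hm]
      · intro i _ hi
        simp [hi.symm]
      · simp
  · rw [hg]
    split_ifs <;> simp

theorem mem_span_X_pow {σ R : Type*} [Finite σ] [CommRing R] (N : ℕ) (f : MvPowerSeries σ R)
    (hf : ∀ m : σ →₀ ℕ, m.degree < N → coeff m f = 0) :
    f ∈ Ideal.span (Set.range (X : σ → MvPowerSeries σ R)) ^ N := by
  cases nonempty_fintype σ
  induction N generalizing f with
  | zero => simp
  | succ N ih =>
    obtain ⟨g, hg, hgc⟩ := exists_eq_sum_X_mul f (by simpa using hf 0 (by simp))
    rw [hg, pow_succ']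
    refine Ideal.sum_mem _ fun i _ => Ideal.mul_mem_mul (Ideal.subset_span ⟨i, rfl⟩) ?_
    refine ih _ fun m hm => ?_
    rcases hgc i m with h | h
    · exact h
    · rw [h]
      exact hf _ (by simpa [map_add] using hm)

theorem mem_span_X_iff {σ R : Type*} [Finite σ] [CommRing R] (f : MvPowerSeries σ R) :
    f ∈ Ideal.span (Set.range (X : σ → MvPowerSeries σ R)) ↔ constantCoeff f = 0 := by
  constructor
  · intro h
    have : Ideal.span (Set.range (X : σ → MvPowerSeries σ R)) ≤
        RingHom.ker (constantCoeff (σ := σ) (R := R)) := by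
      rw [Ideal.span_le]
      rintro _ ⟨i, rfl⟩
      simp [RingHom.mem_ker]
    exact this h
  · intro h
    have := mem_span_X_pow 1 f (fun m hm => by
      have : m = 0 := by simpa [Finsupp.degree_eq_zero_iff] using hm
      simpa [this] using h)
    simpa using this

theorem maximalIdeal_eq_span_X (σ K : Type*) [Finite σ] [Field K] :
    IsLocalRing.maximalIdeal (MvPowerSeries σ K) = Ideal.span (Set.range X) := by
  ext f
  rw [mem_span_X_iff, IsLocalRing.mem_maximalIdeal, mem_nonunits_iff, isUnit_iff_constantCoeff,
    isUnit_iff_ne_zero, not_not]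

theorem ringKrullDim_le_card (σ K : Type*) [Finite σ] [Field K] :
    ringKrullDim (MvPowerSeries σ K) ≤ Nat.card σ := by
  refine (ringKrullDim_le_spanFinrank_maximalIdeal _).trans ?_
  rw [maximalIdeal_eq_span_X]
  have h1 := Submodule.spanFinrank_span_le_ncard_of_finite (R := MvPowerSeries σ K)
    (Set.finite_range (X : σ → MvPowerSeries σ K))
  have h2 : (Set.range (X : σ → MvPowerSeries σ K)).ncard ≤ Nat.card σ := by
    rw [← Set.image_univ, ← Set.ncard_univ]
    exact Set.ncard_image_le (Set.toFinite _)
  exact_mod_cast h1.trans h2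

theorem ringKrullDim_fin (K : Type*) [Field K] (n : ℕ) :
    ringKrullDim (MvPowerSeries (Fin n) K) = n := by
  refine le_antisymm (by simpa using ringKrullDim_le_card (Fin n) K) ?_
  induction n with
  | zero => simpa using ringKrullDim_nonneg_of_nontrivial
  | succ n ih =>
    rw [ringKrullDim_eq_of_ringEquiv (finSuccEquiv K n).toRingEquiv]
    refine le_trans ?_ ringKrullDim_succ_le_ringKrullDim_powerseries
    push_cast
    gcongr

end MvPowerSeries

/-! ### Primes of the generic fiber, and dimension in integral extensions -/

theorem isMaximalInGenericFiber_iff {A B : Type*} [CommRing A] [IsDomain A] [CommRing B]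
    [Algebra A B] {Q : Ideal B} :
    IsMaximalInGenericFiber A Q ↔ Q.IsPrime ∧ Q.comap (algebraMap A B) = ⊥ ∧
      ∀ Q' : Ideal B, Q'.IsPrime → Q'.comap (algebraMap A B) = ⊥ → Q ≤ Q' → Q' = Q := by
  have hdis : ∀ I : Ideal B, I.comap (algebraMap A B) = ⊥ ↔
      Disjoint (Algebra.algebraMapSubmonoid B (nonZeroDivisors A) : Set B) (I : Set B) := by
    intro I
    rw [Set.disjoint_left, eq_bot_iff]
    constructor
    · rintro h _ ⟨a, ha, rfl⟩ hI
      exact nonZeroDivisors.ne_zero ha (h (Ideal.mem_comap.mpr hI))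
    · intro h a ha
      by_contra h0
      exact h ⟨a, mem_nonZeroDivisors_of_ne_zero h0, rfl⟩ ha
  let M := Algebra.algebraMapSubmonoid B (nonZeroDivisors A)
  let L := GenericFiberRing A B
  constructor
  · rintro ⟨hQ, hmax⟩
    have hd : Disjoint (M : Set B) (Q : Set B) :=
      (IsLocalization.map_algebraMap_ne_top_iff_disjoint M L Q).mp hmax.ne_top
    refine ⟨hQ, (hdis Q).mpr hd, fun Q' hQ' hc hle => ?_⟩
    have hd' : Disjoint (M : Set B) (Q' : Set B) := (hdis Q').mp hc
    have := hmax.eq_of_le ((IsLocalization.map_algebraMap_ne_top_iff_disjoint M L Q').mpr hd')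
      (Ideal.map_mono hle)
    have e1 := IsLocalization.under_map_of_isPrime_disjoint M L hQ hd
    have e2 := IsLocalization.under_map_of_isPrime_disjoint M L hQ' hd'
    rw [← e1, ← e2, this]
  · rintro ⟨hQ, hc, hmax⟩
    have hd : Disjoint (M : Set B) (Q : Set B) := (hdis Q).mp hc
    refine ⟨hQ, ?_⟩
    obtain ⟨m, hm, hle⟩ := Ideal.exists_le_maximal _
      ((IsLocalization.map_algebraMap_ne_top_iff_disjoint M L Q).mpr hd)
    have hmp : m.IsPrime := hm.isPrime
    have : m.comap (algebraMap B L) = Q := by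
      refine hmax _ (Ideal.comap_isPrime _ _) ?_ (Ideal.map_le_iff_le_comap.mp hle)
      exact (hdis _).mpr ((IsLocalization.disjoint_under_iff M L m).mpr hm.ne_top)
    have e := IsLocalization.map_under M L m
    change Ideal.map _ (Ideal.comap _ m) = m at e
    rw [this] at e
    exact e ▸ hm

theorem algebraMap_quotient_injective_of_comap_eq_bot {A B : Type*} [CommRing A] [CommRing B]
    [Algebra A B] {P : Ideal B}
    (hP : P.comap (algebraMap A B) = ⊥) : Function.Injective (algebraMap A (B ⧸ P)) := by
  rw [RingHom.injective_iff_ker_eq_bot, ← hP, IsScalarTower.algebraMap_eq A B, ← RingHom.comap_ker]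
  congr 1
  exact Ideal.mk_ker

theorem ringKrullDim_le_of_isIntegral (A S : Type*) [CommRing A] [CommRing S] [Algebra A S]
    [Algebra.IsIntegral A S] : ringKrullDim S ≤ ringKrullDim A := by
  refine Order.krullDim_le_of_strictMono (PrimeSpectrum.comap (algebraMap A S)) ?_
  intro p q hpq
  obtain ⟨x, hx, hxp⟩ := Set.exists_of_ssubset (show (p.asIdeal : Set S) ⊂ q.asIdeal from hpq)
  exact Ideal.comap_lt_comap_of_integral_mem_sdiff (le_of_lt hpq) ⟨hx, hxp⟩
    (Algebra.IsIntegral.isIntegral x)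

/-- Incomparability gives ≤. For ≥, going down over the normal ring A compares the heights of the
two maximal ideals. -/
theorem ringKrullDim_eq_of_isIntegral (A S : Type*) [CommRing A] [IsDomain A] [IsNoetherianRing A]
    [IsLocalRing A] [IsIntegrallyClosed A] [CommRing S] [IsDomain S] [IsLocalRing S]
    [IsNoetherianRing S]
    [Algebra A S] [FaithfulSMul A S] [Algebra.IsIntegral A S] :
    ringKrullDim S = ringKrullDim A := by
  refine le_antisymm (ringKrullDim_le_of_isIntegral A S) ?_
  rw [← IsLocalRing.maximalIdeal_height_eq_ringKrullDim,
    ← IsLocalRing.maximalIdeal_height_eq_ringKrullDim]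
  have hmax : ((IsLocalRing.maximalIdeal S).under A).IsMaximal :=
    Ideal.isMaximal_comap_of_isIntegral_of_isMaximal _
  have : (IsLocalRing.maximalIdeal S).LiesOver (IsLocalRing.maximalIdeal A) :=
    ⟨(IsLocalRing.eq_maximalIdeal hmax).symm⟩
  rw [Ideal.height_eq_height_add_of_liesOver_of_hasGoingDown (IsLocalRing.maximalIdeal A)
    (IsLocalRing.maximalIdeal S)]
  exact_mod_cast le_self_add

/-! ### Weierstrass preparation and primes containing a distinguished polynomial -/

section Weierstrass

open PowerSeries

theorem PowerSeries.map_mk_eq_zero_iff_forall {A : Type*} [CommRing A] (I : Ideal A) (f : A⟦X⟧) :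
    f.map (Ideal.Quotient.mk I) = 0 ↔ ∀ k, coeff k f ∈ I := by
  simp [PowerSeries.ext_iff, Ideal.Quotient.eq_zero_iff_mem]

/-- The lower coefficients of a monic factor lie in the radical of the ideal generated by those of
the product. -/
theorem Polynomial.IsDistinguishedAt.of_dvd {A : Type*} [CommRing A] {I : Ideal A} [I.IsPrime]
    {f g : Polynomial A}
    (hf : f.IsDistinguishedAt I) (hg : g.Monic) (h : g ∣ f) : g.IsDistinguishedAt I := by
  refine ⟨⟨fun {i} hi => ?_⟩, hg⟩
  have := Polynomial.coeff_mem_radical_span_coeff_of_dvd f g hf.monic hg h i hi.ne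
  have hle : (Ideal.span {a | ∃ j, ∃ _ : j < f.natDegree, f.coeff j = a}).radical ≤ I := by
    rw [Ideal.IsRadical.radical_le_iff (Ideal.IsPrime.isRadical ‹_›), Ideal.span_le]
    rintro _ ⟨j, hj, rfl⟩
    exact hf.mem hj
  refine hle ?_
  convert this using 4
  simp

theorem PowerSeries.aeval_mk_X_eq {A : Type*} [CommRing A] {P : Ideal A⟦X⟧} (r : Polynomial A) :
    Polynomial.aeval (Ideal.Quotient.mk P X : A⟦X⟧ ⧸ P) r = Ideal.Quotient.mk P (r : A⟦X⟧) := by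
  induction r using Polynomial.induction_on' with
  | add p q hp hq => simp [hp, hq]
  | monomial k a =>
    rw [← Polynomial.C_mul_X_pow_eq_monomial, map_mul, map_pow, Polynomial.aeval_X,
      Polynomial.aeval_C, Polynomial.coe_mul, Polynomial.coe_pow, Polynomial.coe_X,
      Polynomial.coe_C, map_mul, map_pow]
    rfl

variable {A : Type*} [CommRing A] [IsLocalRing A]
  [IsAdicComplete (IsLocalRing.maximalIdeal A) A]

local notation "𝔪" => IsLocalRing.maximalIdeal A

theorem exists_isDistinguishedAt_mem {P : Ideal A⟦X⟧}
    (h : ∃ f ∈ P, ∃ k, coeff k f ∉ 𝔪) :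
    ∃ g : Polynomial A, g.IsDistinguishedAt 𝔪 ∧ (g : A⟦X⟧) ∈ P := by
  obtain ⟨f, hf, k, hk⟩ := h
  have hne : f.map (IsLocalRing.residue A) ≠ 0 := by
    intro h0
    exact hk ((PowerSeries.map_mk_eq_zero_iff_forall _ _).mp h0 k)
  obtain ⟨g, u, H⟩ := f.exists_isWeierstrassFactorization hne
  refine ⟨g, H.isDistinguishedAt, ?_⟩
  rw [H.eq_mul] at hf
  exact (Ideal.mul_unit_mem_iff_mem P H.isUnit).mp hf

theorem finite_quotient_of_isDistinguishedAt_mem {P : Ideal A⟦X⟧} {g : Polynomial A}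
    (hg : g.IsDistinguishedAt 𝔪) (hgP : (g : A⟦X⟧) ∈ P) : Module.Finite A (A⟦X⟧ ⧸ P) := by
  have := hg.monic.finite_quotient
  have := Module.Finite.equiv hg.algEquivQuotient.toLinearEquiv
  have hle : Ideal.span {(g : A⟦X⟧)} ≤ P := by simpa [Ideal.span_le] using hgP
  exact Module.Finite.of_surjective (Ideal.Quotient.factorₐ A hle).toLinearMap
    (Ideal.Quotient.factor_surjective hle)

/-- The generator is the minimal polynomial g of y modulo P. Over a normal domain g divides every
polynomial that kills y, in particular f and every polynomial lying in P. -/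
theorem exists_isDistinguishedAt_span_eq [IsDomain A] [IsIntegrallyClosed A]
    {P : Ideal A⟦X⟧} [P.IsPrime]
    (hP : P.comap (algebraMap A A⟦X⟧) = ⊥) {f : Polynomial A}
    (hf : f.IsDistinguishedAt 𝔪) (hfP : (f : A⟦X⟧) ∈ P) :
    ∃ g : Polynomial A, g.IsDistinguishedAt 𝔪 ∧ P = Ideal.span {(g : A⟦X⟧)} := by
  let y : A⟦X⟧ ⧸ P := Ideal.Quotient.mk P X
  have : Module.Finite A (A⟦X⟧ ⧸ P) := finite_quotient_of_isDistinguishedAt_mem hf hfP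
  have : FaithfulSMul A (A⟦X⟧ ⧸ P) := (faithfulSMul_iff_algebraMap_injective _ _).mpr
    (algebraMap_quotient_injective_of_comap_eq_bot hP)
  have hy : IsIntegral A y := Algebra.IsIntegral.isIntegral y
  let g := minpoly A y
  have hgd : g ∣ f := minpoly.isIntegrallyClosed_dvd hy
    (by rw [aeval_mk_X_eq, Ideal.Quotient.eq_zero_iff_mem]; exact hfP)
  have hg : g.IsDistinguishedAt 𝔪 := hf.of_dvd (minpoly.monic hy) hgd
  have hgP : (g : A⟦X⟧) ∈ P := by
    rw [← Ideal.Quotient.eq_zero_iff_mem, ← aeval_mk_X_eq]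
    exact minpoly.aeval A y
  refine ⟨g, hg, le_antisymm (fun p hp => ?_) (by simpa [Ideal.span_le] using hgP)⟩
  have hne : (g : A⟦X⟧).map (IsLocalRing.residue A) ≠ 0 := by
    intro h0
    have := congrArg (coeff g.natDegree) h0
    simp [hg.monic] at this
  -- The remainder r is a polynomial lying in P, so it kills y and is a multiple of g; its degree
  -- plays no role.
  obtain ⟨q, r, H⟩ := p.exists_isWeierstrassDivision hne
  have hr : (r : A⟦X⟧) ∈ P := by
    have : (r : A⟦X⟧) = p - g * q := by rw [H.eq_mul_add]; ring
    rw [this]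
    exact P.sub_mem hp (P.mul_mem_right _ hgP)
  have hgr : g ∣ r := minpoly.isIntegrallyClosed_dvd hy
    (by rw [aeval_mk_X_eq, Ideal.Quotient.eq_zero_iff_mem]; exact hr)
  obtain ⟨s, rfl⟩ := hgr
  rw [H.eq_mul_add, Ideal.mem_span_singleton]
  exact dvd_add (dvd_mul_right _ _) ⟨s, by simp⟩

end Weierstrass

/-! ### The uncountable transcendence degree of Frac K[[y]] over K -/

/-- A k-linear functional K → k, applied to coefficients, is k[[X]]-linear and turns a relation over
K into one over k. Functionals separate the elements of K, so the original relation is trivial. -/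
theorem PowerSeries.algebraicIndependent_map {k K ι : Type*} [Field k] [Field K] [Algebra k K]
    {x : ι → PowerSeries k} (hx : AlgebraicIndependent k x) :
    AlgebraicIndependent K fun i => PowerSeries.map (algebraMap k K) (x i) := by
  rw [algebraicIndependent_iff] at hx ⊢
  intro p hp
  ext m
  rw [MvPolynomial.coeff_zero, ← Module.forall_dual_apply_eq_zero_iff k]
  intro l
  let L : PowerSeries K →+ PowerSeries k :=
    { toFun := fun f => PowerSeries.mk fun n => l (PowerSeries.coeff n f)
      map_zero' := by ext; simp
      map_add' := fun f g => by ext; simp }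
  have hL : ∀ (f : PowerSeries k) (c : K),
      L (PowerSeries.C c * PowerSeries.map (algebraMap k K) f) = PowerSeries.C (l c) * f := by
    intro f c
    ext n
    simp only [L, AddMonoidHom.coe_mk, ZeroHom.coe_mk, PowerSeries.coeff_mk,
      PowerSeries.coeff_C_mul,
      PowerSeries.coeff_map]
    rw [mul_comm c, ← Algebra.smul_def, map_smul, smul_eq_mul, mul_comm]
  have h := hx (∑ m ∈ p.support, MvPolynomial.monomial m (l (p.coeff m))) (by
    have := congrArg L hp
    rw [p.as_sum, map_sum, map_sum, map_zero] at this
    rw [map_sum, ← this]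
    refine Finset.sum_congr rfl fun m _ => ?_
    rw [MvPolynomial.aeval_monomial, MvPolynomial.aeval_monomial]
    have := hL (m.prod fun i e => x i ^ e) (p.coeff m)
    rw [Finsupp.prod, map_prod] at this
    simp only [map_pow] at this
    exact this.symm)
  have := congrArg (MvPolynomial.coeff m) h
  classical
  rw [MvPolynomial.coeff_sum] at this
  simp only [MvPolynomial.coeff_monomial] at this
  by_cases hm : m ∈ p.support
  · simpa [hm] using this
  · rw [MvPolynomial.notMem_support_iff.mp hm, map_zero]

-- K itself may be large, so the count is made over its prime field k: k is countable while k[[y]]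
-- is not, and an uncountable independent family in k[[y]] stays independent over K.
open Cardinal in
theorem PowerSeries.aleph0_lt_trdeg {K E : Type u} [Field K] [Field E] [Algebra (PowerSeries K) E]
    [Algebra K E] [IsScalarTower K (PowerSeries K) E] [IsFractionRing (PowerSeries K) E] :
    ℵ₀ < Algebra.trdeg K E := by
  let k : Subfield K := ⊥
  obtain ⟨s, hs⟩ := exists_isTranscendenceBasis k (PowerSeries k)
  have hk : #k ≤ ℵ₀ := by
    have := Subfield.cardinalMk_closure_le_max (∅ : Set K)
    simpa [Subfield.closure_empty] using this
  have hs' : ℵ₀ < #s := by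
    by_contra! hle
    have halg := hs.isAlgebraic
    rw [Subtype.range_coe] at halg
    have h1 := Algebra.IsAlgebraic.cardinalMk_le_max (Algebra.adjoin k s) (PowerSeries k)
    have h2 := Algebra.lift_cardinalMk_adjoin_le k s
    simp only [Cardinal.lift_id] at h2
    have h3 : #(PowerSeries k) ≤ ℵ₀ := h1.trans (max_le (h2.trans (by simp [hk, hle])) le_rfl)
    have h4 : (2 : Cardinal) ^ ℵ₀ ≤ #(PowerSeries k) := by
      have : Function.Injective (fun (S : ℕ → Bool) =>
          (PowerSeries.mk fun n => if S n then 1 else 0 : PowerSeries k)) := by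
        intro S T h
        ext n
        have := congrArg (PowerSeries.coeff n) h
        simp only [PowerSeries.coeff_mk] at this
        cases h1 : S n <;> cases h2 : T n <;> simp [h1, h2] at this ⊢
      have := Cardinal.mk_le_of_injective (this.comp Equiv.ulift.{u}.injective)
      simpa using this
    exact (Cardinal.cantor ℵ₀).not_ge (h4.trans h3)
  have hi : AlgebraicIndependent K fun i : s => algebraMap (PowerSeries K) E
      (PowerSeries.map (algebraMap k K) (i : PowerSeries k)) :=
    (PowerSeries.algebraicIndependent_map hs.1).map'
      (f := IsScalarTower.toAlgHom K (PowerSeries K) E)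
      (IsFractionRing.injective (PowerSeries K) E)
  exact hs'.trans_le hi.cardinalMk_le_trdeg

open Cardinal IntermediateField.algebraAdjoinAdjoin in
theorem PowerSeries.exists_transcendental_adjoin {K E : Type u} [Field K] [Field E]
    [Algebra (PowerSeries K) E]
    [Algebra K E] [IsScalarTower K (PowerSeries K) E] [IsFractionRing (PowerSeries K) E]
    {s : Set E} (hs : s.Countable) :
    ∃ f : PowerSeries K, Transcendental (IntermediateField.adjoin K s)
      (algebraMap (PowerSeries K) E f) := by
  by_contra! h
  simp only [Transcendental, not_not] at h
  have h1 : Algebra.IsAlgebraic (IntermediateField.adjoin K s) E := by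
    refine ⟨fun x => ?_⟩
    obtain ⟨a, b, -, rfl⟩ := IsFractionRing.div_surjective (A := PowerSeries K) x
    rw [div_eq_mul_inv]
    exact (h a).mul (h b).inv
  have h2 : Algebra.IsAlgebraic (Algebra.adjoin K s) E :=
    (IsFractionRing.comap_isAlgebraic_iff (K := IntermediateField.adjoin K s)).mpr h1
  exact (aleph0_lt_trdeg (K := K) (E := E)).not_ge
    ((Algebra.IsAlgebraic.trdeg_le_cardinalMk K s).trans hs.le_aleph0)

/-! ### Field extension of the coefficients, and specialization of a generic slope -/

namespace MvPowerSeries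

/-- An F-linear retraction E → F, applied to coefficients, is F[[x]]-linear, sends the extended
ideal into I and fixes a. -/
theorem comap_map_algebraMap_of_field {σ F E : Type*} [Field F] [Field E] [Algebra F E]
    (I : Ideal (MvPowerSeries σ F)) {a : MvPowerSeries σ F}
    (ha : map (algebraMap F E) a ∈ I.map (map (σ := σ) (algebraMap F E))) : a ∈ I := by
  obtain ⟨l, hl⟩ := LinearMap.exists_leftInverse_of_injective (Algebra.linearMap F E)
    (LinearMap.ker_eq_bot.mpr (algebraMap F E).injective)
  have hl1 : ∀ c : F, l (algebraMap F E c) = c := fun c => LinearMap.congr_fun hl c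
  let L : MvPowerSeries σ E →+ MvPowerSeries σ F :=
    { toFun := fun f m => l (coeff m f)
      map_zero' := by ext m; exact map_zero l
      map_add' := fun f g => by ext m; exact map_add l _ _ }
  have hLc : ∀ f m, coeff m (L f) = l (coeff m f) := fun _ _ => rfl
  have hL : ∀ f g, L (f * map (algebraMap F E) g) = L f * g := by
    classical
    intro f g
    ext m
    rw [hLc, coeff_mul, coeff_mul, map_sum]
    refine Finset.sum_congr rfl fun p _ => ?_
    rw [coeff_map, mul_comm, ← Algebra.smul_def, map_smul, hLc, smul_eq_mul, mul_comm]
  have key : ∀ e ∈ I.map (map (σ := σ) (algebraMap F E)), ∀ s, L (s * e) ∈ I := by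
    intro e he
    induction he using Submodule.span_induction with
    | mem x h =>
      obtain ⟨g, hg, rfl⟩ := h
      intro s
      rw [hL]
      exact I.mul_mem_left _ hg
    | zero => simp
    | add x y _ _ hx hy =>
      intro s
      rw [mul_add, map_add]
      exact I.add_mem (hx s) (hy s)
    | smul t x _ hx =>
      intro s
      rw [smul_eq_mul, ← mul_assoc]
      exact hx _
  have := key _ ha 1
  rwa [one_mul, show L (map (algebraMap F E) a) = a by ext m; rw [hLc, coeff_map, hl1]] at this

/-- Both ideals are extended from a single ideal over k(T), along T ↦ s and T ↦ t. The membership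
descends along the first map and is pushed forward along the second. -/
theorem mem_of_transcendental {σ k E : Type*} [Field k] [Field E] [Algebra k E] {s t : E}
    (hs : Transcendental k s) (ht : Transcendental k t) (J : Ideal (MvPowerSeries σ k))
    (a z w : MvPowerSeries σ k)
    (h : map (algebraMap k E) a ∈
      Ideal.span {map (algebraMap k E) z - C s * map (algebraMap k E) w} ⊔
      J.map (map (σ := σ) (algebraMap k E))) :
    map (algebraMap k E) a ∈ Ideal.span {map (algebraMap k E) z - C t * map (algebraMap k E) w} ⊔
      J.map (map (σ := σ) (algebraMap k E)) := by
  have lift : ∀ r : E, Transcendental k r → ∃ f : RatFunc k →+* E,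
      f RatFunc.X = r ∧ f.comp (algebraMap k (RatFunc k)) = algebraMap k E := by
    intro r hr
    have hinj := transcendental_iff_injective.mp hr
    let g := RatFunc.liftAlgHom (Polynomial.aeval r : Polynomial k →ₐ[k] E)
      (nonZeroDivisors_le_comap_nonZeroDivisors_of_injective _ hinj)
    refine ⟨g, ?_, RingHom.ext fun c => g.commutes c⟩
    have := RatFunc.liftAlgHom_apply_div (Polynomial.aeval r : Polynomial k →ₐ[k] E)
      (nonZeroDivisors_le_comap_nonZeroDivisors_of_injective _ hinj) Polynomial.X 1
    simpa [g] using this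
  obtain ⟨f, hfX, hf⟩ := lift s hs
  obtain ⟨g, hgX, hg⟩ := lift t ht
  let ι := algebraMap k (RatFunc k)
  let I : Ideal (MvPowerSeries σ (RatFunc k)) :=
    Ideal.span {map ι z - C RatFunc.X * map ι w} ⊔ J.map (map (σ := σ) ι)
  have hI : ∀ (r : E) (f : RatFunc k →+* E), f RatFunc.X = r → f.comp ι = algebraMap k E →
      I.map (map (σ := σ) f) =
        Ideal.span {map (algebraMap k E) z - C r * map (algebraMap k E) w} ⊔
          J.map (map (σ := σ) (algebraMap k E)) := by
    rintro r f rfl hf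
    rw [Ideal.map_sup, Ideal.map_span, Set.image_singleton, Ideal.map_map, ← map_comp, hf, map_sub,
      map_mul, map_C, ← hf]
    rfl
  have hm : ∀ f : RatFunc k →+* E, f.comp ι = algebraMap k E →
      map (algebraMap k E) a = map f (map ι a) := by
    rintro f hf
    rw [← hf]
    rfl
  rw [← hI s f hfX hf, hm f hf] at h
  rw [← hI t g hgX hg, hm g hg]
  let := f.toAlgebra
  exact Ideal.mem_map_of_mem _ (comap_map_algebraMap_of_field (F := RatFunc k) (E := E) I h)

/-! ### Exchanging the variables: R[[x]][[y]] and R[[y]][[x]] -/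

variable {σ R : Type*} [CommRing R]

/-- The map underlying the identification of `R[[x]][[y]]` with `R[[y]][[x]]`. -/
noncomputable def swapFun (f : PowerSeries (MvPowerSeries σ R)) : MvPowerSeries σ (PowerSeries R) :=
  fun m => PowerSeries.mk fun k => coeff m (PowerSeries.coeff k f)

/-- The inverse of the identification of `R[[x]][[y]]` with `R[[y]][[x]]`. -/
noncomputable def swapInvFun (f : MvPowerSeries σ (PowerSeries R)) :
    PowerSeries (MvPowerSeries σ R) :=
  PowerSeries.mk fun k => show MvPowerSeries σ R from fun m => PowerSeries.coeff k (coeff m f)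

theorem coeff_coeff_swapFun (f : PowerSeries (MvPowerSeries σ R)) (m : σ →₀ ℕ) (k : ℕ) :
    PowerSeries.coeff k (coeff m (swapFun f)) = coeff m (PowerSeries.coeff k f) := by
  change PowerSeries.coeff k (PowerSeries.mk fun k => coeff m (PowerSeries.coeff k f)) = _
  rw [PowerSeries.coeff_mk]

theorem coeff_coeff_swapInvFun (f : MvPowerSeries σ (PowerSeries R)) (m : σ →₀ ℕ) (k : ℕ) :
    coeff m (PowerSeries.coeff k (swapInvFun f)) = PowerSeries.coeff k (coeff m f) := by
  rw [swapInvFun, PowerSeries.coeff_mk]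
  rfl

variable (σ R) in
/-- The identification of `R[[x]][[y]]` with `R[[y]][[x]]`. -/
noncomputable def swapEquiv :
    PowerSeries (MvPowerSeries σ R) ≃+* MvPowerSeries σ (PowerSeries R) where
  toFun := swapFun
  invFun := swapInvFun
  left_inv f := by
    ext k m
    rw [coeff_coeff_swapInvFun, coeff_coeff_swapFun]
  right_inv f := by
    ext m k
    rw [coeff_coeff_swapFun, coeff_coeff_swapInvFun]
  map_add' f g := by
    ext m k
    simp only [coeff_coeff_swapFun, map_add]
  map_mul' f g := by
    classical
    ext m k
    simp only [coeff_coeff_swapFun, PowerSeries.coeff_mul, coeff_mul, map_sum]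
    rw [Finset.sum_comm]

theorem coeff_coeff_swapEquiv (f : PowerSeries (MvPowerSeries σ R)) (m : σ →₀ ℕ) (k : ℕ) :
    PowerSeries.coeff k (coeff m (swapEquiv σ R f)) = coeff m (PowerSeries.coeff k f) :=
  coeff_coeff_swapFun f m k

theorem swapEquiv_C (f : MvPowerSeries σ R) :
    swapEquiv σ R (PowerSeries.C f) = map PowerSeries.C f := by
  ext m k
  rw [coeff_coeff_swapEquiv, coeff_map, PowerSeries.coeff_C, PowerSeries.coeff_C]
  split_ifs <;> simp

theorem swapEquiv_map_C (f : PowerSeries R) :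
    swapEquiv σ R (PowerSeries.map C f) = C f := by
  classical
  ext m k
  rw [coeff_coeff_swapEquiv, PowerSeries.coeff_map, coeff_C, coeff_C]
  split_ifs <;> simp

end MvPowerSeries

/-- This is Krull's intersection theorem in the localization at M, where each d becomes a unit. -/
theorem Ideal.eq_zero_of_forall_exists_mul_mem_pow {D : Type*} [CommRing D] [IsDomain D]
    [IsNoetherianRing D] (M : Ideal D) [M.IsPrime] {a : D} (h : ∀ N, ∃ d ∉ M, d * a ∈ M ^ N) :
    a = 0 := by
  let L := Localization.AtPrime M
  have : IsNoetherianRing L := IsLocalization.isNoetherianRing M.primeCompl L inferInstance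
  have : IsDomain L := IsLocalization.isDomain_localization M.primeCompl_le_nonZeroDivisors
  rw [← map_eq_zero_iff _ (IsLocalization.injective L M.primeCompl_le_nonZeroDivisors),
    ← Ideal.mem_bot, ← Ideal.iInf_pow_eq_bot_of_isDomain (IsLocalRing.maximalIdeal L)
      Ideal.IsPrime.ne_top', Ideal.mem_iInf]
  intro N
  obtain ⟨d, hd, hda⟩ := h N
  have h2 := Ideal.mem_map_of_mem (algebraMap D L) hda
  rw [map_mul, Ideal.map_pow, Localization.AtPrime.map_eq_maximalIdeal] at h2
  exact (Ideal.unit_mul_mem_iff_mem _ (IsLocalization.map_units L (⟨d, hd⟩ : M.primeCompl))).mp h2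

namespace MvPowerSeries

theorem coeff_eq_zero_of_mem_span_X_pow {σ R : Type*} [CommRing R] {N : ℕ} {f : MvPowerSeries σ R}
    (hf : f ∈ Ideal.span (Set.range (X : σ → MvPowerSeries σ R)) ^ N) {m : σ →₀ ℕ}
    (hm : m.degree < N) : coeff m f = 0 := by
  classical
  induction N generalizing f m with
  | zero => omega
  | succ N ih =>
    rw [pow_succ'] at hf
    induction hf using Submodule.mul_induction_on' with
    | mem_mul_mem a ha b hb =>
      have ha0 : coeff 0 a = 0 := by
        have : Ideal.span (Set.range (X : σ → MvPowerSeries σ R)) ≤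
            RingHom.ker (constantCoeff (σ := σ) (R := R)) := by
          rw [Ideal.span_le]
          rintro _ ⟨i, rfl⟩
          simp [RingHom.mem_ker]
        exact this ha
      rw [coeff_mul]
      refine Finset.sum_eq_zero fun p hp => ?_
      rw [Finset.HasAntidiagonal.mem_antidiagonal] at hp
      by_cases hp1 : p.1 = 0
      · rw [hp1, ha0, zero_mul]
      · have : p.1.degree ≠ 0 := by rwa [ne_eq, Finsupp.degree_eq_zero_iff]
        have h2 : p.1.degree + p.2.degree = m.degree := by rw [← hp, map_add]
        rw [ih hb (by omega), mul_zero]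
    | add a _ b _ ha hb => rw [map_add, ha, hb, add_zero]

theorem swapEquiv_mem_span_X_pow_iff {σ R : Type*} [CommRing R] {N : ℕ}
    {f : PowerSeries (MvPowerSeries σ R)} :
    swapEquiv σ R f ∈ Ideal.span (Set.range X) ^ N ↔
      f ∈ ((Ideal.span (Set.range X)).map
        (algebraMap (MvPowerSeries σ R) (PowerSeries (MvPowerSeries σ R)))) ^ N := by
  have hmap : ((Ideal.span (Set.range X)).map (algebraMap (MvPowerSeries σ R)
      (PowerSeries (MvPowerSeries σ R)))).map (swapEquiv σ R) =
      Ideal.span (Set.range (X : σ → MvPowerSeries σ (PowerSeries R))) := by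
    rw [Ideal.map_span, Ideal.map_span, ← Set.range_comp, ← Set.range_comp]
    congr 2
    ext1 i
    simp only [Function.comp_apply]
    exact (swapEquiv_C _).trans (map_X _ _)
  rw [← hmap, ← Ideal.map_pow, Ideal.mem_map_of_equiv]
  constructor
  · rintro ⟨x, hx, h⟩
    rwa [← (swapEquiv σ R).injective h]
  · exact fun h => ⟨f, h, rfl⟩

end MvPowerSeries

/-! ### Comparison of K[[x]][[y]] with E[[x]], and generic slopes -/

section

variable {K : Type u} [Field K] {n : ℕ}

open MvPowerSeries

theorem mem_extVarIdeal_iff {f : ExtRing K n} :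
    f ∈ extVarIdeal K n ↔ constantCoeff (swapEquiv (Fin n) K f) = 0 := by
  rw [← mem_span_X_iff]
  have := swapEquiv_mem_span_X_pow_iff (N := 1) (f := f)
  rw [pow_one, pow_one] at this
  exact this.symm

theorem mem_extVarIdeal_iff_forall_coeff {f : ExtRing K n} :
    f ∈ extVarIdeal K n ↔ ∀ k, PowerSeries.coeff k f ∈ varIdeal K n := by
  rw [mem_extVarIdeal_iff, PowerSeries.ext_iff]
  refine forall_congr' fun k => ?_
  rw [varIdeal, mem_span_X_iff, ← coeff_zero_eq_constantCoeff_apply, coeff_coeff_swapEquiv,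
    coeff_zero_eq_constantCoeff_apply, map_zero]

instance : (extVarIdeal K n).IsPrime := by
  have : extVarIdeal K n =
      (RingHom.ker (constantCoeff (σ := Fin n) (R := PowerSeries K))).comap
        (swapEquiv (Fin n) K) := by
    ext f
    rw [mem_extVarIdeal_iff, Ideal.mem_comap, RingHom.mem_ker]
  rw [this]
  have := RingHom.ker_isPrime (constantCoeff (σ := Fin n) (R := PowerSeries K))
  exact Ideal.comap_isPrime _ _

theorem map_C_mem_extVarIdeal_iff {d : PowerSeries K} :
    (PowerSeries.map C d : ExtRing K n) ∈ extVarIdeal K n ↔ d = 0 := by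
  rw [mem_extVarIdeal_iff, swapEquiv_map_C, constantCoeff_C]

variable (E : Type u) [Field E] [Algebra (PowerSeries K) E]

variable (K n) in
/-- The map `K[[x]][[y]] → E[[x]]`, where `E` is the fraction field of `K[[y]]`. -/
noncomputable def toGenericCoeffs : ExtRing K n →+* MvPowerSeries (Fin n) E :=
  (map (algebraMap (PowerSeries K) E)).comp (swapEquiv (Fin n) K : ExtRing K n →+* _)

theorem toGenericCoeffs_C [Algebra K E] [IsScalarTower K (PowerSeries K) E] (a : BaseRing K n) :
    toGenericCoeffs K n E (PowerSeries.C a) = map (algebraMap K E) a := by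
  rw [toGenericCoeffs, RingHom.comp_apply, RingHom.coe_coe, swapEquiv_C,
    IsScalarTower.algebraMap_eq K (PowerSeries K) E]
  rfl

theorem toGenericCoeffs_map_C (d : PowerSeries K) :
    toGenericCoeffs K n E (PowerSeries.map C d) = C (algebraMap (PowerSeries K) E d) := by
  rw [toGenericCoeffs, RingHom.comp_apply, RingHom.coe_coe, swapEquiv_map_C, map_C]

variable [IsFractionRing (PowerSeries K) E]

theorem isUnit_toGenericCoeffs {w : ExtRing K n} (hw : w ∉ extVarIdeal K n) :
    IsUnit (toGenericCoeffs K n E w) := by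
  rw [mem_extVarIdeal_iff] at hw
  rw [isUnit_iff_constantCoeff, isUnit_iff_ne_zero, toGenericCoeffs, RingHom.comp_apply,
    RingHom.coe_coe, constantCoeff_map, ne_eq, map_eq_zero_iff _ (IsFractionRing.injective _ _)]
  exact hw

theorem toGenericCoeffs_mem_span_X_pow {N : ℕ} {f : ExtRing K n}
    (hf : toGenericCoeffs K n E f ∈ Ideal.span (Set.range X) ^ N) : f ∈ extVarIdeal K n ^ N := by
  refine swapEquiv_mem_span_X_pow_iff.mp (mem_span_X_pow N _ fun m hm => ?_)
  have := coeff_eq_zero_of_mem_span_X_pow hf hm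
  rwa [toGenericCoeffs, RingHom.comp_apply, RingHom.coe_coe, coeff_map,
    map_eq_zero_iff _ (IsFractionRing.injective _ _)] at this

theorem exists_mul_sub_toGenericCoeffs_mem (N : ℕ) (s : MvPowerSeries (Fin n) E) :
    ∃ d : PowerSeries K, d ≠ 0 ∧ ∃ t : ExtRing K n,
      toGenericCoeffs K n E (PowerSeries.map C d) * s - toGenericCoeffs K n E t ∈
        Ideal.span (Set.range X) ^ N := by
  have hfin : Set.Finite {m : Fin n →₀ ℕ | m.degree ≤ N} := Finsupp.finite_of_degree_le N
  obtain ⟨d, hd⟩ := IsLocalization.exist_integer_multiples (nonZeroDivisors (PowerSeries K))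
    hfin.toFinset fun m => coeff m s
  choose! c hc using hd
  refine ⟨d, nonZeroDivisors.ne_zero d.2, (swapEquiv (Fin n) K).symm
    (show MvPowerSeries (Fin n) (PowerSeries K) from c), ?_⟩
  refine mem_span_X_pow _ _ fun m hm => ?_
  rw [toGenericCoeffs_map_C, toGenericCoeffs, RingHom.comp_apply, RingHom.coe_coe,
    RingEquiv.apply_symm_apply, map_sub, coeff_C_mul, coeff_map, sub_eq_zero, ← Algebra.smul_def]
  exact (hc m (by simpa using hm.le)).symm

/-- Modulo (x)^N only finitely many coefficients in E matter, so one nonzero denominator d in K[[y]]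
clears them. Such a d lies outside XR, which is what the descent needs. -/
theorem exists_mul_sub_mem_of_mem_map {J : Ideal (ExtRing K n)} {u : MvPowerSeries (Fin n) E}
    (hu : u ∈ J.map (toGenericCoeffs K n E)) (N : ℕ) :
    ∃ d : PowerSeries K, d ≠ 0 ∧ ∃ r ∈ J,
      toGenericCoeffs K n E (PowerSeries.map C d) * u - toGenericCoeffs K n E r ∈
        Ideal.span (Set.range X) ^ N := by
  suffices ∀ s, ∃ d : PowerSeries K, d ≠ 0 ∧ ∃ r ∈ J,
      toGenericCoeffs K n E (PowerSeries.map C d) * (s * u) - toGenericCoeffs K n E r ∈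
        Ideal.span (Set.range X) ^ N by simpa using this 1
  induction hu using Submodule.span_induction with
  | mem x h =>
    obtain ⟨g, hg, rfl⟩ := h
    intro s
    obtain ⟨d, hd, t, ht⟩ := exists_mul_sub_toGenericCoeffs_mem (K := K) E N s
    refine ⟨d, hd, t * g, J.mul_mem_left _ hg, ?_⟩
    rw [map_mul, ← mul_assoc, ← sub_mul]
    exact Ideal.mul_mem_right _ _ ht
  | zero => exact fun s => ⟨1, one_ne_zero, 0, J.zero_mem, by simp⟩
  | add x y _ _ hx hy =>
    intro s
    obtain ⟨d, hd, r, hr, h⟩ := hx s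
    obtain ⟨d', hd', r', hr', h'⟩ := hy s
    refine ⟨d * d', mul_ne_zero hd hd', PowerSeries.map C d' * r + PowerSeries.map C d * r',
      J.add_mem (J.mul_mem_left _ hr) (J.mul_mem_left _ hr'), ?_⟩
    convert Ideal.add_mem _
      (Ideal.mul_mem_left _ (toGenericCoeffs K n E (PowerSeries.map C d')) h)
      (Ideal.mul_mem_left _ (toGenericCoeffs K n E (PowerSeries.map C d)) h') using 1
    simp only [map_mul, map_add]
    ring
  | smul t x _ hx =>
    intro s
    rw [smul_eq_mul, ← mul_assoc]
    exact hx _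

/-- For every N, the approximation puts d·a into Q + (XR)^N with some d outside XR. Krull's
intersection theorem in R/Q at the prime XR/Q then gives a ∈ Q. -/
theorem mem_of_toGenericCoeffs_mem_map {Q : Ideal (ExtRing K n)} [hQ : Q.IsPrime]
    (hle : Q ≤ extVarIdeal K n) {a : ExtRing K n}
    (ha : toGenericCoeffs K n E a ∈ Q.map (toGenericCoeffs K n E)) : a ∈ Q := by
  let π := Ideal.Quotient.mk Q
  have hker : RingHom.ker π ≤ extVarIdeal K n := by rwa [Ideal.mk_ker]
  let M := (extVarIdeal K n).map π
  have hM : M.IsPrime := Ideal.map_isPrime_of_surjective Ideal.Quotient.mk_surjective hker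
  have hmem : ∀ f, π f ∈ M → f ∈ extVarIdeal K n := fun f hf => by
    have := Ideal.comap_map_of_surjective' π Ideal.Quotient.mk_surjective (extVarIdeal K n)
    rw [sup_eq_left.mpr hker] at this
    rw [← this]
    exact hf
  refine Ideal.Quotient.eq_zero_iff_mem.mp (M.eq_zero_of_forall_exists_mul_mem_pow fun N => ?_)
  obtain ⟨d, hd, r, hr, h⟩ := exists_mul_sub_mem_of_mem_map E ha N
  rw [← map_mul, ← map_sub] at h
  have h1 := Ideal.mem_map_of_mem π (toGenericCoeffs_mem_span_X_pow E h)
  rw [map_sub, map_mul, Ideal.Quotient.eq_zero_iff_mem.mpr hr, sub_zero, Ideal.map_pow] at h1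
  exact ⟨_, fun hc => hd (map_C_mem_extVarIdeal_iff.mp (hmem _ hc)), h1⟩

/-- The field k generated over K by y and the coefficients of finitely many generators of P is
countably generated, so some f in K[[y]] is transcendental over it. The slopes f + y^j are then all
transcendental over k, while P is extended from k[[x]] and a, z, w have coefficients in K. -/
theorem exists_generic_slopes [Algebra K E] [IsScalarTower K (PowerSeries K) E]
    (P : Ideal (ExtRing K n)) :
    ∃ c : ℕ → PowerSeries K, Function.Injective c ∧ ∀ (a z w : BaseRing K n) (i j : ℕ),
      toGenericCoeffs K n E (PowerSeries.C a) ∈ (Ideal.span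
        {PowerSeries.C z - PowerSeries.map C (c i) * PowerSeries.C w} ⊔ P).map
          (toGenericCoeffs K n E) →
      toGenericCoeffs K n E (PowerSeries.C a) ∈ (Ideal.span
        {PowerSeries.C z - PowerSeries.map C (c j) * PowerSeries.C w} ⊔ P).map
          (toGenericCoeffs K n E) := by
  obtain ⟨s, rfl⟩ : P.FG := IsNoetherian.noetherian P
  -- Including y makes each f + y^j a translate of f by an element of k.
  let T : Set E := insert (algebraMap (PowerSeries K) E PowerSeries.X)
    (⋃ f ∈ (s : Set (ExtRing K n)), Set.range fun m => coeff m (toGenericCoeffs K n E f))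
  have hT : T.Countable :=
    (s.countable_toSet.biUnion fun f _ => Set.countable_range _).insert _
  obtain ⟨f, hf⟩ := PowerSeries.exists_transcendental_adjoin (K := K) hT
  let k := IntermediateField.adjoin K T
  have hy : algebraMap (PowerSeries K) E PowerSeries.X ∈ k :=
    IntermediateField.subset_adjoin _ _ (Set.mem_insert _ _)
  have htr : ∀ j : ℕ, Transcendental k (algebraMap (PowerSeries K) E (f + PowerSeries.X ^ j)) := by
    intro j halg
    apply hf
    have := halg.sub (isAlgebraic_algebraMap ((⟨_, hy⟩ : k) ^ j))
    simpa using this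
  let J : Ideal (MvPowerSeries (Fin n) k) := Ideal.span
    {g | ∃ f ∈ s, map (algebraMap k E) g = toGenericCoeffs K n E f}
  have hJ : J.map (map (algebraMap k E)) =
      (Ideal.span (s : Set (ExtRing K n))).map (toGenericCoeffs K n E) := by
    rw [Ideal.map_span, Ideal.map_span]
    congr 1
    ext g
    constructor
    · rintro ⟨_, ⟨f, hf, h⟩, rfl⟩
      exact ⟨f, hf, h.symm⟩
    · rintro ⟨f, hf, rfl⟩
      have hm : ∀ m, coeff m (toGenericCoeffs K n E f) ∈ k := fun m =>
        IntermediateField.subset_adjoin _ _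
          (Set.mem_insert_of_mem _ (Set.mem_biUnion hf ⟨m, rfl⟩))
      let g : MvPowerSeries (Fin n) k := fun m => ⟨_, hm m⟩
      have hg : map (algebraMap k E) g = toGenericCoeffs K n E f := by
        ext m
        rw [coeff_map]
        rfl
      exact ⟨g, ⟨f, hf, hg⟩, hg⟩
  have hC : ∀ a : BaseRing K n, toGenericCoeffs K n E (PowerSeries.C a) =
      map (algebraMap k E) (map (algebraMap K k) a) := by
    intro a
    rw [toGenericCoeffs_C, IsScalarTower.algebraMap_eq K k E]
    rfl
  refine ⟨fun j => f + PowerSeries.X ^ j, fun i j hij => ?_, fun a z w i j h => ?_⟩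
  · have h : (PowerSeries.X ^ i : PowerSeries K) = PowerSeries.X ^ j := add_left_cancel hij
    have := congrArg PowerSeries.order h
    simpa using this
  · have hI : ∀ j : ℕ, (Ideal.span {PowerSeries.C z - PowerSeries.map C (f + PowerSeries.X ^ j) *
        PowerSeries.C w} ⊔ Ideal.span (s : Set (ExtRing K n))).map (toGenericCoeffs K n E) =
        Ideal.span {map (algebraMap k E) (map (algebraMap K k) z) -
          C (algebraMap (PowerSeries K) E (f + PowerSeries.X ^ j)) *
            map (algebraMap k E) (map (algebraMap K k) w)} ⊔ J.map (map (algebraMap k E)) := by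
      intro j
      rw [Ideal.map_sup, hJ, Ideal.map_span, Set.image_singleton, map_sub, map_mul, hC, hC,
        toGenericCoeffs_map_C]
    change _ ∈ (Ideal.span _ ⊔ Ideal.span (s : Set (ExtRing K n))).map _ at h
    change _ ∈ (Ideal.span _ ⊔ Ideal.span (s : Set (ExtRing K n))).map _
    rw [hI, hC] at h ⊢
    exact mem_of_transcendental (htr i) (htr j) J _ _ _ h

end

/-! ### The pencil argument: XR/P has height at most one -/

theorem Ideal.mem_minimalPrimes_span_singleton_of_height_le_one {S : Type*} [CommRing S]
    [IsDomain S] {q : Ideal S} [hq : q.IsPrime] (h : q.height ≤ 1) {a : S} (ha : a ≠ 0)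
    (haq : a ∈ q) : q ∈ (Ideal.span {a}).minimalPrimes := by
  obtain ⟨p, hp, hpq⟩ := Ideal.exists_minimalPrimes_le (show Ideal.span {a} ≤ q by
    simpa [Ideal.span_le] using haq)
  have := hp.1.1
  rcases hpq.eq_or_lt with rfl | hlt
  · exact hp
  exfalso
  have h0 : (⊥ : Ideal S) < p := bot_lt_iff_ne_bot.mpr fun h0 => ha (by
    have := hp.1.2 (Ideal.mem_span_singleton_self a)
    rwa [h0] at this)
  have h1 := Ideal.height_add_one_le_of_lt_of_isPrime h0
  have h2 := Ideal.height_add_one_le_of_lt_of_isPrime hlt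
  have h3 : (1 : ℕ∞) + 1 ≤ 1 :=
    le_trans (by gcongr; exact le_trans le_add_self h1) (h2.trans h)
  exact absurd h3 (by decide)

/-- If a lay in all such primes, the minimal primes of the z - cⱼw inside M would be among the
finitely many minimal primes of a. Two slopes would share a prime; it would contain w, because cᵢ -
cⱼ is outside M, and hence z. -/
theorem exists_isPrime_mem_and_notMem_of_pencil {S : Type*} [CommRing S] [IsDomain S]
    [IsNoetherianRing S] {M : Ideal S} [M.IsPrime] {z w a : S} (hw : w ≠ 0) (ha : a ≠ 0)
    (hz : ∀ q ∈ (Ideal.span {w}).minimalPrimes, z ∉ q) {c : ℕ → S}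
    (hc : ∀ i j, i ≠ j → c i - c j ∉ M) (hb : ∀ j, z - c j * w ∈ M) :
    ∃ j, ∃ q : Ideal S, q.IsPrime ∧ q ≤ M ∧ z - c j * w ∈ q ∧ a ∉ q := by
  by_contra! H
  have hq : ∀ j, ∃ q ∈ (Ideal.span {z - c j * w}).minimalPrimes, q ≤ M := fun j =>
    Ideal.exists_minimalPrimes_le (by simpa [Ideal.span_le] using hb j)
  choose q hq hqM using hq
  have hqp : ∀ j, (q j).IsPrime := fun j => (hq j).1.1
  have hbq : ∀ j, z - c j * w ∈ q j := fun j => (hq j).1.2 (Ideal.mem_span_singleton_self _)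
  have hht : ∀ j, (q j).height ≤ 1 := fun j =>
    Ideal.height_le_one_of_isPrincipal_of_mem_minimalPrimes _ _ (hq j)
  have haq : ∀ j, q j ∈ (Ideal.span {a}).minimalPrimes := fun j =>
    Ideal.mem_minimalPrimes_span_singleton_of_height_le_one (hht j) ha
      (H j (q j) (hqp j) (hqM j) (hbq j))
  have hfin := Ideal.finite_minimalPrimes_of_isNoetherianRing S (Ideal.span {a})
  obtain ⟨i, -, j, -, hij, he⟩ := Set.infinite_univ.exists_ne_map_eq_of_mapsTo
    (fun j _ => haq j) hfin
  have hwq : w ∈ q i := by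
    have h1 : (c i - c j) * w ∈ q i := by
      have := (q i).sub_mem (he ▸ hbq j) (hbq i)
      convert this using 1
      ring
    exact ((hqp i).mem_or_mem h1).resolve_left fun h => hc i j hij (hqM i h)
  refine hz (q i) (Ideal.mem_minimalPrimes_span_singleton_of_height_le_one (hht i) hw hwq) ?_
  have := (q i).add_mem (hbq i) ((q i).mul_mem_left (c i) hwq)
  rwa [sub_add_cancel] at this

section

variable {K : Type u} [Field K] {n : ℕ}

open MvPowerSeries

theorem height_map_extVarIdeal_le_one (hn : 0 < n) {P : Ideal (ExtRing K n)} [hP : P.IsPrime]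
    (hPX : P ≤ extVarIdeal K n) (hPA : P.comap (algebraMap (BaseRing K n) (ExtRing K n)) = ⊥)
    (hmax : ∀ Q : Ideal (ExtRing K n), Q.IsPrime →
      Q.comap (algebraMap (BaseRing K n) (ExtRing K n)) = ⊥ → P ≤ Q → Q ≤ extVarIdeal K n → Q = P) :
    ((extVarIdeal K n).map (Ideal.Quotient.mk P)).height ≤ 1 := by
  by_contra hht
  let π := Ideal.Quotient.mk P
  have hker : RingHom.ker π ≤ extVarIdeal K n := by rwa [Ideal.mk_ker]
  set M := (extVarIdeal K n).map π with hMdef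
  have hM : M.IsPrime := Ideal.map_isPrime_of_surjective Ideal.Quotient.mk_surjective hker
  have hmem : ∀ f, π f ∈ M → f ∈ extVarIdeal K n := fun f hf => by
    have := Ideal.comap_map_of_surjective' π Ideal.Quotient.mk_surjective (extVarIdeal K n)
    rw [sup_eq_left.mpr hker] at this
    rw [← this]
    exact hf
  have hC : ∀ a : BaseRing K n, a ∈ varIdeal K n → π (PowerSeries.C a) ∈ M := fun a ha =>
    Ideal.mem_map_of_mem π (Ideal.mem_map_of_mem (algebraMap (BaseRing K n) (ExtRing K n)) ha)
  have hC0 : ∀ a : BaseRing K n, a ≠ 0 → π (PowerSeries.C a) ≠ 0 := fun a ha h =>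
    ha (by
      have : a ∈ P.comap (algebraMap (BaseRing K n) (ExtRing K n)) :=
        Ideal.mem_comap.mpr (Ideal.Quotient.eq_zero_iff_mem.mp h)
      rwa [hPA] at this)
  let w : BaseRing K n := X ⟨0, hn⟩
  have hw : w ∈ varIdeal K n := Ideal.subset_span ⟨_, rfl⟩
  have hw0 : w ≠ 0 := fun h => by
    have := congrArg (coeff (Finsupp.single ⟨0, hn⟩ 1)) h
    simp [w] at this
  have hwmin := Ideal.finite_minimalPrimes_of_isNoetherianRing _ (Ideal.span {π (PowerSeries.C w)})
  -- Prime avoidance in A: otherwise M would lie in a minimal prime of w and have height at most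
  -- one.
  obtain ⟨z, hz, hzq⟩ : ∃ z ∈ varIdeal K n,
      ∀ q ∈ (Ideal.span {π (PowerSeries.C w)}).minimalPrimes, π (PowerSeries.C z) ∉ q := by
    by_contra! H
    have hsub : (varIdeal K n : Set (BaseRing K n)) ⊆ ⋃ q ∈ (hwmin.toFinset : Set (Ideal _)),
        (q.comap (π.comp PowerSeries.C) : Set (BaseRing K n)) := by
      intro z hz
      obtain ⟨q, hq, hzq⟩ := H z hz
      exact Set.mem_biUnion (by simpa using hq) hzq
    obtain ⟨q, hq, hle⟩ := (Ideal.subset_union_prime ⊥ ⊥ fun q hq _ _ => by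
      have : q.IsPrime := (hwmin.mem_toFinset.mp hq).1.1
      exact Ideal.comap_isPrime _ _).mp hsub
    have hq := hwmin.mem_toFinset.mp hq
    have hMq : M ≤ q := by
      rw [hMdef, extVarIdeal, Ideal.map_map]
      exact Ideal.map_le_iff_le_comap.mpr hle
    exact hht ((Ideal.height_mono hMq).trans
      (Ideal.height_le_one_of_isPrincipal_of_mem_minimalPrimes _ _ hq))
  let E := FractionRing (PowerSeries K)
  obtain ⟨c, hcinj, hc⟩ := exists_generic_slopes E P
  let B : ℕ → ExtRing K n := fun j =>
    PowerSeries.C z - PowerSeries.map C (c j) * PowerSeries.C w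
  have hπB : ∀ j, π (B j) =
      π (PowerSeries.C z) - π (PowerSeries.map C (c j)) * π (PowerSeries.C w) := fun j => by
    simp only [B, map_sub, map_mul]
  have hBM : ∀ j, π (PowerSeries.C z) - π (PowerSeries.map C (c j)) * π (PowerSeries.C w) ∈ M :=
    fun j => M.sub_mem (hC z hz) (M.mul_mem_left _ (hC w hw))
  obtain ⟨v, hv, a, ha, hva⟩ : ∃ v ∉ extVarIdeal K n, ∃ a : BaseRing K n, a ≠ 0 ∧
      v * PowerSeries.C a ∈ Ideal.span {B 0} ⊔ P := by
    by_contra! H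
    -- A prime disjoint from N is exactly one that lies in XR and contracts to 0, so maximality of P
    -- applies. It would give z = c₀w in R/P, against the choice of z.
    let N : Submonoid (ExtRing K n) := (extVarIdeal K n).primeCompl ⊔
      (nonZeroDivisors (BaseRing K n)).map (algebraMap (BaseRing K n) (ExtRing K n))
    obtain ⟨Q, hQ, hle, hdis⟩ := Ideal.exists_le_prime_disjoint (Ideal.span {B 0} ⊔ P) N (by
      rw [Set.disjoint_right]
      intro x hx
      obtain ⟨v, hv, _, ⟨a, ha, rfl⟩, rfl⟩ := Submonoid.mem_sup.mp hx
      exact H v hv a (nonZeroDivisors.ne_zero ha))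
    rw [Set.disjoint_left] at hdis
    have hQP : Q = P := by
      refine hmax Q hQ (eq_bot_iff.mpr fun a ha => ?_) (le_sup_right.trans hle) fun f hf => ?_
      · by_contra h0
        exact hdis ha (Submonoid.mem_sup_right ⟨a, mem_nonZeroDivisors_of_ne_zero h0, rfl⟩)
      · by_contra hf'
        exact hdis hf (Submonoid.mem_sup_left hf')
    have hB : π (B 0) = 0 := by
      rw [Ideal.Quotient.eq_zero_iff_mem, ← hQP]
      exact hle (Ideal.mem_sup_left (Ideal.mem_span_singleton_self _))
    obtain ⟨q, hq, -⟩ := Ideal.exists_minimalPrimes_le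
      (show Ideal.span {π (PowerSeries.C w)} ≤ M by simpa [Ideal.span_le] using hC w hw)
    refine hzq q hq ?_
    rw [hπB, sub_eq_zero] at hB
    rw [hB]
    exact q.mul_mem_left _ (hq.1.2 (Ideal.mem_span_singleton_self _))
  -- The factor v has nonzero constant term in E and becomes a unit of E[[x]].
  have ha0 : toGenericCoeffs K n E (PowerSeries.C a) ∈
      (Ideal.span {B 0} ⊔ P).map (toGenericCoeffs K n E) := by
    have := Ideal.mem_map_of_mem (toGenericCoeffs K n E) hva
    rw [map_mul] at this
    exact (Ideal.unit_mul_mem_iff_mem _ (isUnit_toGenericCoeffs E hv)).mp this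
  obtain ⟨j, q, hq, hqM, hbq, haq⟩ := exists_isPrime_mem_and_notMem_of_pencil
    (hC0 w hw0) (hC0 a ha) hzq (c := fun j => π (PowerSeries.map C (c j)))
    (fun i j hij h => by
      rw [← map_sub, ← map_sub] at h
      exact hij (hcinj (sub_eq_zero.mp (map_C_mem_extVarIdeal_iff.mp (hmem _ h))))) hBM
  have hQ : (q.comap π).IsPrime := Ideal.comap_isPrime _ _
  refine haq (mem_of_toGenericCoeffs_mem_map E (Q := q.comap π) (fun f hf => hmem f (hqM hf))
    (Ideal.map_mono ?_ (hc a z w 0 j ha0)))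
  refine sup_le ?_ fun f hf => ?_
  · rw [Ideal.span_singleton_le_iff_mem, Ideal.mem_comap]
    exact (hπB j) ▸ hbq
  · rw [Ideal.mem_comap, Ideal.Quotient.eq_zero_iff_mem.mpr hf]
    exact q.zero_mem

end

/-! ### Noether normalization adapted to XR, and the lower bound on the height -/

theorem IsPrecomplete.pi {B ι : Type*} [CommRing B] [Finite ι] (I : Ideal B) [IsPrecomplete I B] :
    IsPrecomplete I (ι → B) := by
  classical
  cases nonempty_fintype ι
  have hsub : ∀ (n : ℕ) (x : ι → B), x ∈ (I ^ n • ⊤ : Submodule B (ι → B)) ↔ ∀ i, x i ∈ I ^ n := by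
    intro n x
    constructor
    · intro hx i
      have := Submodule.mem_map_of_mem (f := LinearMap.proj (R := B) (φ := fun _ : ι => B) i) hx
      rw [Submodule.map_smul''] at this
      exact Ideal.mul_le_left this
    · intro hx
      rw [pi_eq_sum_univ' x]
      refine Submodule.sum_mem _ fun i _ => ?_
      exact Submodule.smul_mem_smul (hx i) trivial
  refine ⟨fun f hf => ?_⟩
  have h1 : ∀ i, ∃ L, ∀ n, f n i ≡ L [SMOD (I ^ n • ⊤ : Submodule B B)] := by
    intro i
    refine IsPrecomplete.prec' (fun n => f n i) fun {m n} hmn => ?_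
    have := (hsub m _).mp (SModEq.sub_mem.mp (hf hmn)) i
    rw [SModEq.sub_mem]
    simpa using this
  choose L hL using h1
  refine ⟨L, fun n => SModEq.sub_mem.mpr ((hsub n _).mpr fun i => ?_)⟩
  simpa using SModEq.sub_mem.mp (hL i n)

/-- A complete form of Nakayama's lemma: S/𝔪^N is finitely generated over B by dévissage along
powers of 𝔪, so S/IS is too, and generators lift because B is precomplete and S is separated. -/
theorem Module.finite_of_isPrecomplete_of_pow_le {B S : Type*} [CommRing B] [CommRing S]
    [IsLocalRing S] [IsNoetherianRing S] [Algebra B S] (I : Ideal B) [IsPrecomplete I B]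
    (hI : I.map (algebraMap B S) ≠ ⊤)
    (hpow : ∃ N, IsLocalRing.maximalIdeal S ^ N ≤ I.map (algebraMap B S))
    (hsurj : ∀ s : S, ∃ b : B, s - algebraMap B S b ∈ IsLocalRing.maximalIdeal S) :
    Module.Finite B S := by
  classical
  have hT : ∀ N : ℕ, ∃ T : Finset S, ∀ s : S, ∃ t ∈ Submodule.span B (T : Set S),
      s - t ∈ IsLocalRing.maximalIdeal S ^ N := by
    intro N
    induction N with
    | zero => exact ⟨∅, fun s => ⟨0, Submodule.zero_mem _, by simp⟩⟩
    | succ N ih =>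
      obtain ⟨T, hT⟩ := ih
      obtain ⟨G, hG⟩ : (IsLocalRing.maximalIdeal S ^ N).FG := IsNoetherian.noetherian _
      refine ⟨T ∪ G, fun s => ?_⟩
      obtain ⟨t, ht, hst⟩ := hT s
      have key : ∀ r ∈ IsLocalRing.maximalIdeal S ^ N, ∃ t ∈ Submodule.span B (G : Set S),
          r - t ∈ IsLocalRing.maximalIdeal S ^ (N + 1) := by
        intro r hr
        have hr' := hr
        rw [← hG] at hr'
        induction hr' using Submodule.span_induction with
        | mem x h => exact ⟨x, Submodule.subset_span h, by simp⟩
        | zero => exact ⟨0, Submodule.zero_mem _, by simp⟩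
        | add x y hx hy ihx ihy =>
          obtain ⟨t, ht, h⟩ := ihx (hG ▸ hx)
          obtain ⟨t', ht', h'⟩ := ihy (hG ▸ hy)
          exact ⟨t + t', Submodule.add_mem _ ht ht', by
            rw [add_sub_add_comm]; exact Ideal.add_mem _ h h'⟩
        | smul c x hx ihx =>
          have hxm : x ∈ IsLocalRing.maximalIdeal S ^ N := hG ▸ hx
          obtain ⟨t, ht, h⟩ := ihx hxm
          obtain ⟨b, hb⟩ := hsurj c
          refine ⟨b • t, Submodule.smul_mem _ _ ht, ?_⟩
          have : c • x - b • t = (c - algebraMap B S b) * x + algebraMap B S b * (x - t) := by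
            rw [smul_eq_mul, Algebra.smul_def]; ring
          rw [this]
          refine Ideal.add_mem _ ?_ (Ideal.mul_mem_left _ _ h)
          rw [pow_succ']
          exact Ideal.mul_mem_mul hb hxm
      obtain ⟨t', ht', h'⟩ := key _ hst
      refine ⟨t + t', Submodule.add_mem _ (Submodule.span_mono (by simp) ht)
        (Submodule.span_mono (by simp) ht'), ?_⟩
      rwa [← sub_sub]
  obtain ⟨N, hN⟩ := hpow
  obtain ⟨T, hT⟩ := hT N
  have : IsHausdorff (I.map (algebraMap B S)) S := IsHausdorff.of_isLocalRing _ _ hI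
  have : IsHausdorff I S := IsHausdorff.map_algebraMap_iff.mp this
  have : IsPrecomplete I (T → B) := IsPrecomplete.pi I
  let f : (T → B) →ₗ[B] S := Fintype.linearCombination B (fun t : T => (t : S))
  have hf : Function.Surjective ((I • ⊤ : Submodule B S).mkQ ∘ₗ f) := by
    intro q
    obtain ⟨s, rfl⟩ := Submodule.mkQ_surjective _ q
    obtain ⟨t, ht, hst⟩ := hT s
    have : t ∈ LinearMap.range f := by
      rw [Fintype.range_linearCombination]
      simpa using ht
    obtain ⟨v, rfl⟩ := this
    refine ⟨v, ?_⟩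
    rw [LinearMap.comp_apply, ← sub_eq_zero, ← map_sub, Submodule.mkQ_apply,
      Submodule.Quotient.mk_eq_zero, Ideal.smul_top_eq_map, ← neg_sub, neg_mem_iff]
    exact hN hst
  exact Module.Finite.of_surjective f (surjective_of_mkQ_comp_surjective hf)

theorem ringKrullDim_lt_of_isIntegral_of_not_injective {B S : Type*} [CommRing B] [IsDomain B]
    [CommRing S] [Algebra B S] [Algebra.IsIntegral B S]
    (h : ¬ Function.Injective (algebraMap B S)) : ringKrullDim S + 1 ≤ ringKrullDim B := by
  obtain ⟨b, hb, hb0⟩ : ∃ b, algebraMap B S b = 0 ∧ b ≠ 0 := by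
    by_contra! H
    exact h ((injective_iff_map_eq_zero _).mpr H)
  let g : B ⧸ Ideal.span {b} →+* S := Ideal.Quotient.lift _ (algebraMap B S) (by
    intro x hx
    obtain ⟨y, rfl⟩ := Ideal.mem_span_singleton.mp hx
    rw [map_mul, hb, zero_mul])
  let := g.toAlgebra
  have : IsScalarTower B (B ⧸ Ideal.span {b}) S := .of_algebraMap_eq fun x => rfl
  have : Algebra.IsIntegral (B ⧸ Ideal.span {b}) S := Algebra.IsIntegral.tower_top B
  refine le_trans ?_ (ringKrullDim_quotient_succ_le_of_nonZeroDivisor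
    (mem_nonZeroDivisors_of_ne_zero hb0))
  gcongr
  exact ringKrullDim_le_of_isIntegral _ _

namespace MvPowerSeries

theorem isPrime_span_X {σ R : Type*} [CommRing R] [IsDomain R] (s : σ) :
    (Ideal.span {(X s : MvPowerSeries σ R)}).IsPrime := by
  let e : {i // i ≠ s} ↪ σ := Function.Embedding.subtype _
  have : Ideal.span {(X s : MvPowerSeries σ R)} = RingHom.ker (killCompl (R := R) e) := by
    ext f
    rw [Ideal.mem_span_singleton, X_dvd_iff, RingHom.mem_ker, MvPowerSeries.ext_iff]
    constructor
    · intro h x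
      rw [coeff_killCompl]
      refine h _ (Finsupp.embDomain_of_notMem_range _ _ _ ?_)
      rintro ⟨i, hi⟩
      exact i.2 hi
    · intro h m hm
      obtain ⟨x, rfl⟩ := (Finsupp.mem_range_embDomain_iff e m).mpr fun i hi =>
        ⟨⟨i, fun h => by subst h; simp [hm] at hi⟩, rfl⟩
      rw [← coeff_killCompl, h, map_zero]
  rw [this]
  exact RingHom.ker_isPrime _

theorem two_le_height {σ R : Type*} [CommRing R] [IsDomain R] {p : Ideal (MvPowerSeries σ R)}
    [p.IsPrime] {s t : σ} (hst : s ≠ t) (hs : X s ∈ p) (ht : X t ∈ p) : 2 ≤ p.height := by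
  classical
  have := isPrime_span_X (R := R) s
  have h0 : (⊥ : Ideal (MvPowerSeries σ R)) < Ideal.span {X s} := by
    rw [bot_lt_iff_ne_bot, ne_eq, Ideal.span_singleton_eq_bot]
    intro h
    have := congrArg (coeff (Finsupp.single s 1)) h
    simp at this
  have h1 : Ideal.span {X s} < p := by
    refine lt_of_le_of_ne (by simpa [Ideal.span_le] using hs) fun h => ?_
    rw [← h, Ideal.mem_span_singleton, X_dvd_iff] at ht
    have := ht (Finsupp.single t 1) (Finsupp.single_eq_of_ne hst)
    simp at this
  have h2 := Ideal.height_add_one_le_of_lt_of_isPrime h0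
  have h3 := Ideal.height_add_one_le_of_lt_of_isPrime h1
  calc (2 : ℕ∞) = 1 + 1 := (one_add_one_eq_two).symm
    _ ≤ (Ideal.span {(X s : MvPowerSeries σ R)}).height + 1 := by
      gcongr; exact le_trans le_add_self h2
    _ ≤ p.height := h3

end MvPowerSeries

section

variable {K : Type u} [Field K] {n : ℕ}

open MvPowerSeries

theorem exists_sub_X_mul_mem_extVarIdeal {f : ExtRing K n}
    (hf : f ∈ IsLocalRing.maximalIdeal (ExtRing K n)) :
    ∃ g, f - PowerSeries.X * g ∈ extVarIdeal K n := by
  obtain ⟨d, hd⟩ : PowerSeries.X ∣ constantCoeff (swapEquiv (Fin n) K f) := by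
    rw [PowerSeries.X_dvd_iff]
    by_contra h
    rw [IsLocalRing.mem_maximalIdeal, mem_nonunits_iff] at hf
    refine hf ((MulEquiv.isUnit_map (swapEquiv (Fin n) K)).mp ?_)
    rw [isUnit_iff_constantCoeff, PowerSeries.isUnit_iff_constantCoeff]
    exact isUnit_iff_ne_zero.mpr h
  refine ⟨PowerSeries.map C d, ?_⟩
  have hX : (PowerSeries.X : ExtRing K n) = PowerSeries.map C PowerSeries.X := by simp
  rw [mem_extVarIdeal_iff, hX, ← map_mul (PowerSeries.map C), map_sub, swapEquiv_map_C, map_sub,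
    constantCoeff_C, hd, sub_self]

theorem X_notMem_extVarIdeal : (PowerSeries.X : ExtRing K n) ∉ extVarIdeal K n := by
  have hX : (PowerSeries.X : ExtRing K n) = PowerSeries.map C PowerSeries.X := by simp
  rw [hX, map_C_mem_extVarIdeal_iff]
  exact PowerSeries.X_ne_zero

theorem mem_maximalIdeal_extRing_iff {f : ExtRing K n} :
    f ∈ IsLocalRing.maximalIdeal (ExtRing K n) ↔
      constantCoeff ((optionEquivLeft (Fin n) K).symm f) = 0 := by
  rw [IsLocalRing.mem_maximalIdeal, mem_nonunits_iff,
    ← MulEquiv.isUnit_map (optionEquivLeft (Fin n) K).symm, isUnit_iff_constantCoeff,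
    isUnit_iff_ne_zero, not_not]

theorem exists_sub_algebraMap_mem_maximalIdeal (f : ExtRing K n) :
    ∃ c : K, f - algebraMap K (ExtRing K n) c ∈ IsLocalRing.maximalIdeal (ExtRing K n) := by
  refine ⟨constantCoeff ((optionEquivLeft (Fin n) K).symm f), ?_⟩
  rw [mem_maximalIdeal_extRing_iff, map_sub, AlgEquiv.commutes, map_sub, sub_eq_zero]
  exact (constantCoeff_C _).symm

/-- The substitution homomorphism out of a power series ring in finitely many variables. -/
theorem exists_algHom_extRing {σ : Type*} [Finite σ] (r : σ → ExtRing K n)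
    (hr : ∀ i, r i ∈ IsLocalRing.maximalIdeal (ExtRing K n)) :
    ∃ F : MvPowerSeries σ K →ₐ[K] ExtRing K n, ∀ i, F (X i) = r i := by
  have h : HasSubst fun i => (optionEquivLeft (Fin n) K).symm (r i) :=
    hasSubst_of_constantCoeff_zero fun i => mem_maximalIdeal_extRing_iff.mp (hr i)
  refine ⟨((optionEquivLeft (Fin n) K : _ →ₐ[K] _)).comp (substAlgHom h), fun i => ?_⟩
  rw [AlgHom.comp_apply, substAlgHom_X]
  exact AlgEquiv.apply_symm_apply _ _

theorem IsLocalRing.comap_maximalIdeal_of_surjective {R S : Type*} [CommRing R] [CommRing S]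
    [IsLocalRing R] [IsLocalRing S] {f : R →+* S} (hf : Function.Surjective f) :
    (maximalIdeal S).comap f = maximalIdeal R :=
  eq_maximalIdeal (Ideal.comap_isMaximal_of_surjective f hf)

theorem IsLocalRing.maximalIdeal_le_radical_of_mem_minimalPrimes {S : Type*} [CommRing S]
    [IsLocalRing S] {I : Ideal S} (h : maximalIdeal S ∈ I.minimalPrimes) :
    maximalIdeal S ≤ I.radical := by
  rw [Ideal.radical_eq_sInf]
  exact le_sInf fun q hq => h.2 ⟨hq.2, hq.1⟩ (le_maximalIdeal hq.2.ne_top)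

theorem IsLocalRing.exists_finset_card_eq_ringKrullDim (T : Type*) [CommRing T] [IsLocalRing T]
    [IsNoetherianRing T] : ∃ s : Finset T, maximalIdeal T ∈ (Ideal.span (s : Set T)).minimalPrimes ∧
      ringKrullDim T = s.card := by
  obtain ⟨s, hs, hcard⟩ :=
    Ideal.exists_finset_card_eq_height_of_isNoetherianRing (maximalIdeal T)
  refine ⟨s, hs, ?_⟩
  rw [← maximalIdeal_height_eq_ringKrullDim, ← hcard]
  rfl

theorem IsLocalRing.exists_surjective_ker_eq_span_singleton {S : Type u} [CommRing S] [IsDomain S]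
    [IsLocalRing S] [IsNoetherianRing S] {y : S} (hym : y ∈ maximalIdeal S) (hy0 : y ≠ 0) :
    ∃ (T : Type u) (_ : CommRing T) (_ : IsLocalRing T) (_ : IsNoetherianRing T) (τ : S →+* T),
      Function.Surjective τ ∧ RingHom.ker τ = Ideal.span {y} ∧
        ringKrullDim T + 1 = ringKrullDim S := by
  have : Nontrivial (S ⧸ Ideal.span {y}) := Ideal.Quotient.nontrivial_iff.mpr fun h =>
    IsLocalRing.notMem_maximalIdeal.mpr isUnit_one
      ((Ideal.span_singleton_le_iff_mem _).mpr hym (h ▸ Submodule.mem_top : (1 : S) ∈ _))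
  refine ⟨S ⧸ Ideal.span {y}, inferInstance,
    IsLocalRing.of_surjective' (Ideal.Quotient.mk _) Ideal.Quotient.mk_surjective, inferInstance,
    Ideal.Quotient.mk _, Ideal.Quotient.mk_surjective, Ideal.mk_ker, le_antisymm ?_ ?_⟩
  · exact ringKrullDim_quotient_succ_le_of_nonZeroDivisor (mem_nonZeroDivisors_of_ne_zero hy0)
  · have h1 : ringKrullDim S ≤ ringKrullDim (S ⧸ Ideal.span {y}) + ({y} : Set S).encard :=
      ringKrullDim_le_ringKrullDim_quotient_add_encard {y} (by
        rw [Set.singleton_subset_iff, SetLike.mem_coe, IsLocalRing.ringJacobson_eq_maximalIdeal]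
        exact hym)
    rwa [Set.encard_singleton] at h1

/-- A system of parameters of S = R/P is chosen with y as one member and all others in M = XR/P. It
gives a finite injection B → S from a power series ring, and M ∩ B contains at least two variables.
-/
theorem two_le_height_map_extVarIdeal {P : Ideal (ExtRing K n)} [hP : P.IsPrime]
    (hPX : P ≤ extVarIdeal K n) (hdim : 3 ≤ ringKrullDim (ExtRing K n ⧸ P)) :
    2 ≤ ((extVarIdeal K n).map (Ideal.Quotient.mk P)).height := by
  let S := ExtRing K n ⧸ P
  let π : ExtRing K n →+* S := Ideal.Quotient.mk P
  have hπ : Function.Surjective π := Ideal.Quotient.mk_surjective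
  have : IsLocalRing S := IsLocalRing.of_surjective' π hπ
  have hmS : ∀ f, π f ∈ IsLocalRing.maximalIdeal S ↔ f ∈ IsLocalRing.maximalIdeal _ := fun f => by
    rw [← IsLocalRing.comap_maximalIdeal_of_surjective hπ, Ideal.mem_comap]
  have hM : ((extVarIdeal K n).map π).IsPrime :=
    Ideal.map_isPrime_of_surjective hπ (by rwa [Ideal.mk_ker])
  have hXm : (PowerSeries.X : ExtRing K n) ∈ IsLocalRing.maximalIdeal _ := by
    rw [IsLocalRing.mem_maximalIdeal, mem_nonunits_iff, PowerSeries.isUnit_iff_constantCoeff]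
    simp
  have hXle : extVarIdeal K n ≤ IsLocalRing.maximalIdeal _ :=
    IsLocalRing.le_maximalIdeal Ideal.IsPrime.ne_top'
  set y := π PowerSeries.X with hy
  have hym : y ∈ IsLocalRing.maximalIdeal S := (hmS _).mpr hXm
  have hy0 : y ≠ 0 := fun h =>
    X_notMem_extVarIdeal (hPX (Ideal.Quotient.eq_zero_iff_mem.mp h))
  obtain ⟨T, _, _, _, τ, hτ, hker, hTS⟩ :=
    IsLocalRing.exists_surjective_ker_eq_span_singleton hym hy0
  obtain ⟨s, hs, hT⟩ := IsLocalRing.exists_finset_card_eq_ringKrullDim T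
  have hcard : (s.card : WithBot ℕ∞) + 1 = ringKrullDim S := hT ▸ hTS
  have hs2 : 2 ≤ s.card := by
    have h2 : (3 : WithBot ℕ∞) ≤ s.card + 1 := hdim.trans_eq hcard.symm
    have h3 : 3 ≤ s.card + 1 := by exact_mod_cast h2
    omega
  -- A lift of t can be altered by a multiple of y, which vanishes in T = S/(y), and f is congruent
  -- to a multiple of y modulo XR.
  have hz : ∀ t : s, ∃ z ∈ extVarIdeal K n, τ (π z) = t := by
    intro t
    obtain ⟨x, hx⟩ := hτ t
    obtain ⟨f, rfl⟩ := hπ x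
    have htm : (t : T) ∈ IsLocalRing.maximalIdeal T := hs.1.2 (Ideal.subset_span t.2)
    rw [← hx, ← Ideal.mem_comap, IsLocalRing.comap_maximalIdeal_of_surjective hτ, hmS] at htm
    obtain ⟨g, hg⟩ := exists_sub_X_mul_mem_extVarIdeal htm
    refine ⟨_, hg, ?_⟩
    have : τ y = 0 := by
      rw [← RingHom.mem_ker, hker]
      exact Ideal.mem_span_singleton_self y
    rw [map_sub, map_sub, map_mul, map_mul, ← hy, this, zero_mul, sub_zero, hx]
  choose z hzX hzt using hz
  let r : Option s → ExtRing K n := fun o => o.elim PowerSeries.X z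
  obtain ⟨F, hF⟩ := exists_algHom_extRing r (by
    rintro (_ | t)
    · exact hXm
    · exact hXle (hzX t))
  let B := MvPowerSeries (Option s) K
  let G : B →+* S := π.comp (F : B →+* ExtRing K n)
  let := G.toAlgebra
  have hG : ∀ i, algebraMap B S (X i) = π (r i) := fun i => congrArg π (hF i)
  let I : Ideal B := Ideal.span (Set.range X)
  have hrI : ∀ i, π (r i) ∈ I.map (algebraMap B S) := fun i =>
    hG i ▸ Ideal.mem_map_of_mem _ (Ideal.subset_span ⟨i, rfl⟩)
  have hIle : I.map (algebraMap B S) ≤ IsLocalRing.maximalIdeal S := by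
    rw [Ideal.map_span, Ideal.span_le]
    rintro _ ⟨_, ⟨i, rfl⟩, rfl⟩
    rw [hG]
    cases i with
    | none => exact hym
    | some t => exact (hmS _).mpr (hXle (hzX t))
  have hpow : ∃ N, IsLocalRing.maximalIdeal S ^ N ≤ I.map (algebraMap B S) := by
    have hle : (Ideal.span (s : Set T)).comap τ ≤ I.map (algebraMap B S) := by
      have h1 : Ideal.span (s : Set T) ≤ (I.map (algebraMap B S)).map τ := by
        rw [Ideal.span_le]
        intro t ht
        have hzt' : τ (π (z ⟨t, ht⟩)) = t := hzt ⟨t, ht⟩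
        rw [← hzt']
        exact Ideal.mem_map_of_mem τ (hrI (some ⟨t, ht⟩))
      refine (Ideal.comap_mono h1).trans ?_
      rw [Ideal.comap_map_of_surjective' τ hτ, hker]
      exact sup_le le_rfl ((Ideal.span_singleton_le_iff_mem _).mpr (hrI none))
    have hrad : IsLocalRing.maximalIdeal S ≤ (I.map (algebraMap B S)).radical := by
      rw [← IsLocalRing.comap_maximalIdeal_of_surjective hτ]
      refine (Ideal.comap_mono
        (IsLocalRing.maximalIdeal_le_radical_of_mem_minimalPrimes hs)).trans ?_
      rw [Ideal.comap_radical]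
      exact Ideal.radical_mono hle
    obtain ⟨N, hN⟩ := Ideal.exists_radical_pow_le_of_fg (I.map (algebraMap B S))
      (IsNoetherian.noetherian _)
    exact ⟨N, (Ideal.pow_right_mono hrad N).trans hN⟩
  have hfin : Module.Finite B S := by
    refine Module.finite_of_isPrecomplete_of_pow_le I
      (ne_top_of_le_ne_top Ideal.IsPrime.ne_top' hIle) hpow fun x => ?_
    obtain ⟨f, rfl⟩ := hπ x
    obtain ⟨c, hc⟩ := exists_sub_algebraMap_mem_maximalIdeal f
    refine ⟨algebraMap K B c, ?_⟩
    have : algebraMap B S (algebraMap K B c) = π (algebraMap K (ExtRing K n) c) :=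
      congrArg π (F.commutes c)
    rw [this, ← map_sub, hmS]
    exact hc
  -- A nonzero kernel would give dim S < dim B ≤ |s| + 1 = dim S.
  have hinj : Function.Injective (algebraMap B S) := by
    by_contra h
    have h1 := ringKrullDim_lt_of_isIntegral_of_not_injective h
    have h2 := h1.trans (ringKrullDim_le_card (Option s) K)
    have h3 : (s.card : WithBot ℕ∞) + 1 + 1 ≤ (Nat.card (Option s) : ℕ) :=
      hcard ▸ h2
    have h4 : Nat.card (Option s) = s.card + 1 := by simp
    rw [h4] at h3
    have h5 : s.card + 1 + 1 ≤ s.card + 1 := by exact_mod_cast h3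
    omega
  have : FaithfulSMul B S := (faithfulSMul_iff_algebraMap_injective _ _).mpr hinj
  have : ((extVarIdeal K n).map π).LiesOver (((extVarIdeal K n).map π).under B) :=
    Ideal.over_under _
  change 2 ≤ ((extVarIdeal K n).map π).height
  rw [Ideal.height_eq_height_add_of_liesOver_of_hasGoingDown
    (((extVarIdeal K n).map π).under B) ((extVarIdeal K n).map π)]
  obtain ⟨t₁, ht₁, t₂, ht₂, hne⟩ := Finset.one_lt_card.mp hs2
  have hmem : ∀ t : s, X (some t) ∈ ((extVarIdeal K n).map π).under B := fun t => by
    rw [Ideal.mem_comap, hG]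
    exact Ideal.mem_map_of_mem π (hzX t)
  refine le_add_right
    (two_le_height (s := some ⟨t₁, ht₁⟩) (t := some ⟨t₂, ht₂⟩) ?_ (hmem _) (hmem _))
  simpa using hne

end

/-! ### Maximal primes inside XR and the final assembly -/

section

variable {A B : Type*} [CommRing A] [CommRing B] [Algebra A B]

theorem Ideal.eq_of_le_of_comap_eq_bot_of_isIntegral [Nontrivial A] {P Q : Ideal B} [P.IsPrime]
    [Algebra.IsIntegral A (B ⧸ P)] (hPQ : P ≤ Q)
    (hQ : Q.comap (algebraMap A B) = ⊥) : Q = P := by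
  have h : (Q.map (Ideal.Quotient.mk P)).comap (algebraMap A (B ⧸ P)) = ⊥ := by
    rw [← hQ, IsScalarTower.algebraMap_eq A B, ← Ideal.comap_comap]
    congr 1
    exact Ideal.comap_map_mk hPQ
  refine le_antisymm ?_ hPQ
  have := Ideal.map_eq_bot_iff_le_ker _ |>.mp (Ideal.eq_bot_of_comap_eq_bot h)
  rwa [Ideal.mk_ker] at this

theorem ringKrullDim_quotient_succ_le_of_lt {P Q : Ideal B} [P.IsPrime] (h : P < Q) :
    ringKrullDim (B ⧸ Q) + 1 ≤ ringKrullDim (B ⧸ P) := by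
  obtain ⟨x, hxQ, hxP⟩ := SetLike.exists_of_lt h
  refine ringKrullDim_succ_le_of_surjective (Ideal.Quotient.factor h.le)
    (Ideal.Quotient.factor_surjective h.le) (r := Ideal.Quotient.mk P x)
    (mem_nonZeroDivisors_of_ne_zero fun h0 => hxP (Ideal.Quotient.eq_zero_iff_mem.mp h0)) ?_
  rw [Ideal.Quotient.factor_mk]
  exact Ideal.Quotient.eq_zero_iff_mem.mpr hxQ

theorem Ideal.exists_maximal_prime_of_le [IsNoetherianRing B] {P : Ideal B} (s : Set (Ideal B))
    (hP : P ∈ s) :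
    ∃ Q ∈ s, P ≤ Q ∧ ∀ Q' ∈ s, Q ≤ Q' → Q' = Q := by
  obtain ⟨Q, ⟨hQs, hPQ⟩, hQ⟩ := set_has_maximal_iff_noetherian.mpr ‹IsNoetherianRing B›
    {Q | Q ∈ s ∧ P ≤ Q} ⟨P, hP, le_rfl⟩
  exact ⟨Q, hQs, hPQ, fun Q' hs hle =>
    (eq_of_le_of_not_lt hle (hQ Q' ⟨hs, hPQ.trans hle⟩)).symm⟩

end

section

variable {K : Type u} [Field K] {n : ℕ}

theorem comap_extVarIdeal_ne_bot (hn : 0 < n) :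
    (extVarIdeal K n).comap (algebraMap (BaseRing K n) (ExtRing K n)) ≠ ⊥ := by
  intro h
  have : (MvPowerSeries.X ⟨0, hn⟩ : BaseRing K n) ∈
      (extVarIdeal K n).comap (algebraMap (BaseRing K n) (ExtRing K n)) :=
    Ideal.mem_map_of_mem _ (Ideal.subset_span ⟨_, rfl⟩)
  rw [h, Ideal.mem_bot] at this
  have h1 := congrArg (MvPowerSeries.coeff (Finsupp.single ⟨0, hn⟩ 1)) this
  rw [MvPowerSeries.coeff_index_single_self_X, map_zero] at h1
  exact one_ne_zero h1

theorem maximalIdeal_baseRing_eq_varIdeal (K : Type u) [Field K] (n : ℕ) :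
    IsLocalRing.maximalIdeal (BaseRing K n) = varIdeal K n :=
  MvPowerSeries.maximalIdeal_eq_span_X (Fin n) K

instance : IsAdicComplete (IsLocalRing.maximalIdeal (BaseRing K n)) (BaseRing K n) := by
  rw [maximalIdeal_baseRing_eq_varIdeal]
  exact inferInstanceAs (IsAdicComplete (Ideal.span (Set.range MvPowerSeries.X)) _)

theorem exists_isWeierstrassPolynomial_mem {P : Ideal (ExtRing K n)} (hPX : ¬ P ≤ extVarIdeal K n) :
    ∃ g : Polynomial (BaseRing K n), IsWeierstrassPolynomial g ∧ (g : ExtRing K n) ∈ P := by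
  obtain ⟨f, hfP, hf⟩ := SetLike.not_le_iff_exists.mp hPX
  rw [mem_extVarIdeal_iff_forall_coeff, not_forall] at hf
  simp only [IsWeierstrassPolynomial]
  rw [← maximalIdeal_baseRing_eq_varIdeal] at hf ⊢
  exact exists_isDistinguishedAt_mem ⟨f, hfP, hf⟩

theorem finite_quotient_of_not_le_extVarIdeal {P : Ideal (ExtRing K n)}
    (hPX : ¬ P ≤ extVarIdeal K n) : Module.Finite (BaseRing K n) (ExtRing K n ⧸ P) := by
  obtain ⟨g, hg, hgP⟩ := exists_isWeierstrassPolynomial_mem hPX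
  rw [IsWeierstrassPolynomial, ← maximalIdeal_baseRing_eq_varIdeal] at hg
  exact finite_quotient_of_isDistinguishedAt_mem hg hgP

theorem exists_isWeierstrassPolynomial_span_eq {P : Ideal (ExtRing K n)} [P.IsPrime]
    (hPX : ¬ P ≤ extVarIdeal K n)
    (hPA : P.comap (algebraMap (BaseRing K n) (ExtRing K n)) = ⊥) :
    ∃ g : Polynomial (BaseRing K n), IsWeierstrassPolynomial g ∧
      P = Ideal.span {(g : ExtRing K n)} := by
  obtain ⟨f, hf, hfP⟩ := exists_isWeierstrassPolynomial_mem hPX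
  simp only [IsWeierstrassPolynomial] at hf ⊢
  rw [← maximalIdeal_baseRing_eq_varIdeal] at hf ⊢
  exact exists_isDistinguishedAt_span_eq hPA hf hfP

theorem ringKrullDim_quotient_of_not_le_extVarIdeal {P : Ideal (ExtRing K n)} [P.IsPrime]
    (hPX : ¬ P ≤ extVarIdeal K n)
    (hPA : P.comap (algebraMap (BaseRing K n) (ExtRing K n)) = ⊥) :
    ringKrullDim (ExtRing K n ⧸ P) = n := by
  have := finite_quotient_of_not_le_extVarIdeal hPX
  have : FaithfulSMul (BaseRing K n) (ExtRing K n ⧸ P) :=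
    (faithfulSMul_iff_algebraMap_injective _ _).mpr
      (algebraMap_quotient_injective_of_comap_eq_bot hPA)
  have : IsLocalRing (ExtRing K n ⧸ P) :=
    IsLocalRing.of_surjective' (Ideal.Quotient.mk P) Ideal.Quotient.mk_surjective
  rw [ringKrullDim_eq_of_isIntegral (BaseRing K n), MvPowerSeries.ringKrullDim_fin]

theorem isMaximalInGenericFiber_of_not_le_extVarIdeal {P : Ideal (ExtRing K n)} [hP : P.IsPrime]
    (hPX : ¬ P ≤ extVarIdeal K n)
    (hPA : P.comap (algebraMap (BaseRing K n) (ExtRing K n)) = ⊥) :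
    IsMaximalInGenericFiber (BaseRing K n) P := by
  have := finite_quotient_of_not_le_extVarIdeal hPX
  exact isMaximalInGenericFiber_iff.mpr ⟨hP, hPA, fun Q _ hQ hPQ =>
    Ideal.eq_of_le_of_comap_eq_bot_of_isIntegral hPQ hQ⟩

theorem two_le_ringKrullDim_quotient {Q : Ideal (ExtRing K n)} [Q.IsPrime]
    (hQX : Q < extVarIdeal K n) : 2 ≤ ringKrullDim (ExtRing K n ⧸ Q) := by
  have hX : extVarIdeal K n < IsLocalRing.maximalIdeal (ExtRing K n) := by
    refine lt_of_le_of_ne (IsLocalRing.le_maximalIdeal Ideal.IsPrime.ne_top') fun h => ?_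
    refine X_notMem_extVarIdeal (K := K) (n := n) (h ▸ ?_)
    rw [IsLocalRing.mem_maximalIdeal, mem_nonunits_iff, PowerSeries.isUnit_iff_constantCoeff]
    simp
  have h1 := ringKrullDim_quotient_succ_le_of_lt hQX
  have h2 := ringKrullDim_quotient_succ_le_of_lt hX
  have h3 : 0 ≤ ringKrullDim (ExtRing K n ⧸ IsLocalRing.maximalIdeal (ExtRing K n)) :=
    ringKrullDim_nonneg_of_nontrivial
  calc (2 : WithBot ℕ∞) = 0 + 1 + 1 := by norm_num
    _ ≤ _ := (add_le_add_left ((add_le_add_left h3 1).trans h2) 1).trans h1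

theorem ringKrullDim_quotient_le_two (hn : 0 < n) {P : Ideal (ExtRing K n)} [P.IsPrime]
    (hPX : P ≤ extVarIdeal K n)
    (hPA : P.comap (algebraMap (BaseRing K n) (ExtRing K n)) = ⊥)
    (hmax : ∀ Q : Ideal (ExtRing K n), Q.IsPrime →
      Q.comap (algebraMap (BaseRing K n) (ExtRing K n)) = ⊥ → P ≤ Q → Q ≤ extVarIdeal K n → Q = P) :
    ringKrullDim (ExtRing K n ⧸ P) ≤ 2 := by
  by_contra! h
  have h3 : 3 ≤ ringKrullDim (ExtRing K n ⧸ P) := ENat.WithBot.add_one_le_iff.mpr h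
  have := (two_le_height_map_extVarIdeal hPX h3).trans
    (height_map_extVarIdeal_le_one hn hPX hPA hmax)
  exact absurd this (by norm_num)

theorem exists_le_isMaximalInGenericFiber (hn : 2 ≤ n) {P : Ideal (ExtRing K n)} [hP : P.IsPrime]
    (hPX : P ≤ extVarIdeal K n)
    (hPA : P.comap (algebraMap (BaseRing K n) (ExtRing K n)) = ⊥) :
    ∃ Q : Ideal (ExtRing K n), Q.IsPrime ∧ P ≤ Q ∧ Q < extVarIdeal K n ∧
      ringKrullDim (ExtRing K n ⧸ Q) = 2 ∧ IsMaximalInGenericFiber (BaseRing K n) Q := by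
  -- Q is maximal only among the primes inside XR; primes outside XR are excluded afterwards by
  -- dimension.
  obtain ⟨Q, ⟨hQ, hQA, hQX⟩, hPQ, hmax⟩ := Ideal.exists_maximal_prime_of_le
    {Q : Ideal (ExtRing K n) | Q.IsPrime ∧
      Q.comap (algebraMap (BaseRing K n) (ExtRing K n)) = ⊥ ∧ Q ≤ extVarIdeal K n} ⟨hP, hPA, hPX⟩
  have hlt : Q < extVarIdeal K n := lt_of_le_of_ne hQX fun h =>
    comap_extVarIdeal_ne_bot (by omega) (h ▸ hQA)
  have hdim : ringKrullDim (ExtRing K n ⧸ Q) = 2 :=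
    le_antisymm (ringKrullDim_quotient_le_two (by omega) hQX hQA
      fun Q' h1 h2 h3 h4 => hmax Q' ⟨h1, h2, h4⟩ h3) (two_le_ringKrullDim_quotient hlt)
  refine ⟨Q, hQ, hPQ, hlt, hdim, isMaximalInGenericFiber_iff.mpr
    ⟨hQ, hQA, fun Q' hQ' hQA' hle => ?_⟩⟩
  by_cases hX : Q' ≤ extVarIdeal K n
  · exact hmax Q' ⟨hQ', hQA', hX⟩ hle
  -- Here n ≥ 2 is essential: a larger Q' outside XR has dim R/Q' = n, whereas Q < Q' leaves at most
  -- 1.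
  · by_contra hne
    have h1 := ringKrullDim_quotient_succ_le_of_lt (lt_of_le_of_ne hle (Ne.symm hne))
    rw [hdim, ringKrullDim_quotient_of_not_le_extVarIdeal hX hQA'] at h1
    have h2 : n + 1 ≤ 2 := by exact_mod_cast h1
    omega

end

theorem theorem7p1 {K : Type*} [Field K] (n : ℕ) (hn : 2 ≤ n) :
    (∀ P : Ideal (ExtRing K n), P.IsPrime →
      P.comap (algebraMap (BaseRing K n) (ExtRing K n)) = ⊥ →
        (¬ P ≤ extVarIdeal K n →
          (∃ g : Polynomial (BaseRing K n), IsWeierstrassPolynomial g ∧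
            P = Ideal.span {(g : ExtRing K n)}) ∧
          ringKrullDim (ExtRing K n ⧸ P) = n ∧
          IsMaximalInGenericFiber (BaseRing K n) P) ∧
        (P ≤ extVarIdeal K n →
          ∃ Q : Ideal (ExtRing K n), Q.IsPrime ∧ P ≤ Q ∧
            ringKrullDim (ExtRing K n ⧸ Q) = 2 ∧
            IsMaximalInGenericFiber (BaseRing K n) Q)) ∧
    (∀ Q : Ideal (ExtRing K n), IsMaximalInGenericFiber (BaseRing K n) Q →
      (ringKrullDim (ExtRing K n ⧸ Q) = n ∧
        Function.Injective (algebraMap (BaseRing K n) (ExtRing K n ⧸ Q)) ∧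
        Module.Finite (BaseRing K n) (ExtRing K n ⧸ Q)) ∨
      (ringKrullDim (ExtRing K n ⧸ Q) = 2 ∧ Q < extVarIdeal K n)) := by
  refine ⟨fun P hP hPA => ⟨fun hPX => ⟨exists_isWeierstrassPolynomial_span_eq hPX hPA,
    ringKrullDim_quotient_of_not_le_extVarIdeal hPX hPA,
    isMaximalInGenericFiber_of_not_le_extVarIdeal hPX hPA⟩, fun hPX => ?_⟩, fun Q hQ => ?_⟩
  · obtain ⟨Q, hQ, hPQ, -, hdim, hmax⟩ := exists_le_isMaximalInGenericFiber hn hPX hPA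
    exact ⟨Q, hQ, hPQ, hdim, hmax⟩
  · obtain ⟨hQp, hQA, hmax⟩ := isMaximalInGenericFiber_iff.mp hQ
    by_cases hQX : Q ≤ extVarIdeal K n
    · obtain ⟨Q', hQ', hle, hlt, hdim, hmax'⟩ := exists_le_isMaximalInGenericFiber hn hQX hQA
      obtain rfl := hmax Q' hQ' (isMaximalInGenericFiber_iff.mp hmax').2.1 hle
      exact Or.inr ⟨hdim, hlt⟩
    · exact Or.inl ⟨ringKrullDim_quotient_of_not_le_extVarIdeal hQX hQA,
        algebraMap_quotient_injective_of_comap_eq_bot hQA,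
        finite_quotient_of_not_le_extVarIdeal hQX⟩
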